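/- Let $d,m\ge 0$ and $p>q\ge 0$ be integers, $A_1,\dots,A_p\in\mathbb R^{d\times d}$, $B_0,\dots,B_q\in\mathbb R^{d\times m}$, and put $$A(\lambda)=I_d\lambda^p+A_1\lambda^{p-1}+\dots+A_p,\qquad B(\lambda)=B_0\lambda^q+\dots+B_q,\qquad F(\lambda)=A(\lambda)^{-1}B(\lambda).$$ For a square matrix polynomial $P$ write $\sigma(P(\cdot))=\{\lambda\in\mathbb C:\det P(\lambda)=0\}$. Assume the following. (i) $A(\lambda)$ and $B(\lambda)$ are left coprime: every common left divisor in $\mathbb C[\lambda]^{d\times d}$ is unimodular. (ii) $R_1,\dots,R_p\in\mathbb C^{d\times d}$ is a complete set of regular right solvents of $A(\lambda)$. That is, $R_k^p+A_1R_k^{p-1}+\dots+A_p=0$ for every $k$; $A(\lambda)=Q_k(\lambda)(\lambda I_d-R_k)$ with a matrix polynomial $Q_k$ such that $\sigma(R_k)\cap\sigma(Q_k(\cdot))=\emptyset$; and $\sigma(A(\cdot))=\bigcup_{k=1}^p\sigma(R_k)$. (iii) $\sigma(A(\cdot))\subset\{z\in\mathbb C:\operatorname{Re}z<0\}$. (iv)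 $L=(L(t))_{t\in\mathbb R}$ is a two-sided $\mathbb R^m$-valued Lévy process ($L(0)=0$ a.s., stationary independent increments, càdlàg paths) with $\mathbb E\|L(1)\|^2<\infty$ and $\mathbb E L(1)=0$. Let $\Sigma_L=\operatorname{Cov}(L(1))$. For each $k$ let $$\operatorname{res}[F,R_k]=\frac1{2\pi i}\oint_{\Gamma_k}F(\lambda)\,d\lambda,$$ where $\Gamma_k$ is a positively oriented, piecewise continuously differentiable simple closed contour with $\sigma(R_k)$ in its interior and $\sigma(A(\cdot))\setminus\sigma(R_k)$ in its exterior. Let $Y=(Y(t))_{t\in\mathbb R}$ be the stationary MCARMA process with, for every $t\in\mathbb R$, almost surely $$Y(t)=\sum_{k=1}^pY_k(t),\qquad Y_k(t)=\int_{-\infty}^t e^{R_k(t-u)}\operatorname{res}[F,R_k]\,dL(u).$$ Here the integral over $[s,t]$ is the limit in probability of Riemann sums as the mesh tends to $0$, and the integral over $(-\infty,t]$ is the limit in probability of the integrals over $[s,t]$ as $s\to-\infty$. Then $Y(t)$ is square integrable for every $t$, the integrals below converge absolutely, and for all real $t$ and all real $l\ge 0$ the autocovariance $\gamma_Y(l)=\operatorname{Cov}(Y(t+l),Y(t))$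 is independent of $t$ and equals $$\gamma_Y(l)=\sum_{i=1}^p e^{lR_i}\,\Sigma_i,\qquad \Sigma_i=\sum_{j=1}^p\int_0^\infty e^{uR_i}\operatorname{res}[F,R_i]\,\Sigma_L\,\operatorname{res}[F,R_j]^{\mathsf H}e^{uR_j^{\mathsf H}}\,du,$$ where $Z^{\mathsf H}$ is the conjugate transpose of $Z$ and $\operatorname{Cov}(U,V)=\mathbb E[(U-\mathbb EU)(V-\mathbb EV)^{\mathsf H}]$. -/

import Mathlib

open MeasureTheory ProbabilityTheory Filter Topology Matrix Polynomial

namespace MCARMA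

noncomputable section

/-! ### Matrix polynomials -/

/-- The monic matrix polynomial `A(z) = z ^ p I + z ^ (p - 1) A₁ + ... + A_p`, as a matrix with
entries in `ℂ[X]`. The coefficient `A_{k+1}` is `A k`, for `k = 0, ..., p - 1`. -/
def arPoly {p d : ℕ} (A : Fin p → Matrix (Fin d) (Fin d) ℝ) : Matrix (Fin d) (Fin d) ℂ[X] :=
  Matrix.of fun a b =>
    (if a = b then X ^ p else 0) + ∑ k : Fin p, C ((A k a b : ℝ) : ℂ) * X ^ (p - 1 - (k : ℕ))

/-- The matrix polynomial `B(z) = z ^ q B₀ + z ^ (q - 1) B₁ + ... + B_q`. -/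
def maPoly {q d m : ℕ} (B : Fin (q + 1) → Matrix (Fin d) (Fin m) ℝ) :
    Matrix (Fin d) (Fin m) ℂ[X] :=
  Matrix.of fun a b => ∑ j : Fin (q + 1), C ((B j a b : ℝ) : ℂ) * X ^ (q - (j : ℕ))

/-- The value at `z ∈ ℂ` of a matrix polynomial. -/
def evalAt {d m : ℕ} (z : ℂ) (P : Matrix (Fin d) (Fin m) ℂ[X]) : Matrix (Fin d) (Fin m) ℂ :=
  P.map fun f => f.eval z

/-- The spectrum `σ(P(·)) = {z | det P(z) = 0}` of a square matrix polynomial. -/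
def polySpectrum {d : ℕ} (P : Matrix (Fin d) (Fin d) ℂ[X]) : Set ℂ :=
  {z | (evalAt z P).det = 0}

/-- Left coprimeness: every common left divisor of `P` and `Q` is unimodular. -/
def LeftCoprime {d m : ℕ} (P : Matrix (Fin d) (Fin d) ℂ[X]) (Q : Matrix (Fin d) (Fin m) ℂ[X]) :
    Prop :=
  ∀ (D P' : Matrix (Fin d) (Fin d) ℂ[X]) (Q' : Matrix (Fin d) (Fin m) ℂ[X]),
    P = D * P' → Q = D * Q' → IsUnit D

/-- `R` is a right solvent of `A(z)`: `R ^ p + A₁ R ^ (p - 1) + ... + A_p = 0`. -/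
def IsRightSolvent {p d : ℕ} (A : Fin p → Matrix (Fin d) (Fin d) ℝ)
    (R : Matrix (Fin d) (Fin d) ℂ) : Prop :=
  R ^ p + ∑ k : Fin p, (A k).map (fun x : ℝ => (x : ℂ)) * R ^ (p - 1 - (k : ℕ)) = 0

/-- A regular right solvent: a right solvent `R` with `A(z) = Q(z) (z I - R)` for a matrix
polynomial `Q` such that `σ(R)` and `σ(Q(·))` are disjoint. (The quotient `Q` is unique and is
automatically monic of degree `p - 1`; `R.charmatrix` is `z I - R`.) -/
def IsRegularRightSolvent {p d : ℕ} (A : Fin p → Matrix (Fin d) (Fin d) ℝ)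
    (R : Matrix (Fin d) (Fin d) ℂ) : Prop :=
  IsRightSolvent A R ∧
    ∃ Q : Matrix (Fin d) (Fin d) ℂ[X],
      arPoly A = Q * R.charmatrix ∧ Disjoint (spectrum ℂ R) (polySpectrum Q)

/-- A complete set of `p` regular right solvents: `σ(A(·))` is the union of the `σ(R_k)`. -/
def IsCompleteRegularSolventSet {p d : ℕ} (A : Fin p → Matrix (Fin d) (Fin d) ℝ)
    (R : Fin p → Matrix (Fin d) (Fin d) ℂ) : Prop :=
  (∀ k, IsRegularRightSolvent A (R k)) ∧ polySpectrum (arPoly A) = ⋃ k, spectrum ℂ (R k)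

/-- The rational matrix function `F(z) = A(z)⁻¹ B(z)`. -/
def transferFun {p q d m : ℕ} (A : Fin p → Matrix (Fin d) (Fin d) ℝ)
    (B : Fin (q + 1) → Matrix (Fin d) (Fin m) ℝ) (z : ℂ) : Matrix (Fin d) (Fin m) ℂ :=
  (evalAt z (arPoly A))⁻¹ * evalAt z (maPoly B)

/-! ### Contours and residues -/

/-- A simple closed contour `Γ : [0, 1] → ℂ`: continuous, closed, without self-intersections, and
continuously differentiable with bounded derivative off finitely many parameters. -/
structure IsSimpleClosedContour (Γ : ℝ → ℂ) : Prop where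
  continuousOn : ContinuousOn Γ (Set.Icc 0 1)
  closed : Γ 0 = Γ 1
  injOn : Set.InjOn Γ (Set.Ico 0 1)
  piecewise : ∃ s : Finset ℝ, ∃ c : ℝ,
    ∀ t ∈ Set.Ioo (0 : ℝ) 1, t ∉ s → ContDiffAt ℝ 1 Γ t ∧ ‖deriv Γ t‖ ≤ c

/-- The contour integral `∮_Γ f(z) dz`. -/
def contourIntegral (Γ : ℝ → ℂ) (f : ℂ → ℂ) : ℂ :=
  ∫ t in (0 : ℝ)..1, deriv Γ t * f (Γ t)

/-- The winding number of `Γ` about `z`. -/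
def windingNumber (Γ : ℝ → ℂ) (z : ℂ) : ℂ :=
  (2 * (Real.pi : ℂ) * Complex.I)⁻¹ * contourIntegral Γ fun w => (w - z)⁻¹

/-- `Γ` is a simple closed contour, positively oriented, with every point of `S` in its interior
(off the curve, winding number `1`) and every point of `T` in its exterior (off the curve,
winding number `0`). -/
structure Separates (Γ : ℝ → ℂ) (S T : Set ℂ) : Prop where
  contour : IsSimpleClosedContour Γ
  interior : ∀ z ∈ S, z ∉ Γ '' Set.Icc 0 1 ∧ windingNumber Γ z = 1
  exterior : ∀ z ∈ T, z ∉ Γ '' Set.Icc 0 1 ∧ windingNumber Γ z = 0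

/-- `(2 π i)⁻¹ ∮_Γ F(z) dz`. This is the residue `res[F, R]` when `Γ` separates `σ(R)` from
`σ(A(·)) \ σ(R)`. -/
def contourResidue {d m : ℕ} (F : ℂ → Matrix (Fin d) (Fin m) ℂ) (Γ : ℝ → ℂ) :
    Matrix (Fin d) (Fin m) ℂ :=
  Matrix.of fun a b =>
    (2 * (Real.pi : ℂ) * Complex.I)⁻¹ * contourIntegral Γ fun z => F z a b

/-! ### Lévy processes and stochastic integrals -/

/-- A two-sided `ℝᵐ`-valued Lévy process. -/
structure IsTwoSidedLevy {Ω : Type*} [MeasurableSpace Ω] {m : ℕ}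
    (L : ℝ → Ω → (Fin m → ℝ)) (μ : Measure Ω) : Prop where
  measurable : ∀ t, Measurable (L t)
  zero : ∀ᵐ ω ∂μ, L 0 ω = 0
  indep : HasIndepIncrements L μ
  stationary : ∀ s t h : ℝ,
    IdentDistrib (fun ω => L (t + h) ω - L (s + h) ω) (fun ω => L t ω - L s ω) μ μ
  cadlag : ∀ᵐ ω ∂μ, ∀ t : ℝ, ContinuousWithinAt (fun s => L s ω) (Set.Ici t) t ∧
    ∃ l : Fin m → ℝ, Tendsto (fun s => L s ω) (𝓝[<] t) (𝓝 l)

/-- `s = τ 0 ≤ τ 1 ≤ ... ≤ τ n = t`. -/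
def IsPartition (s t : ℝ) (n : ℕ) (τ : ℕ → ℝ) : Prop :=
  τ 0 = s ∧ τ n = t ∧ ∀ i < n, τ i ≤ τ (i + 1)

/-- The sum `∑_{i < n} g(τ i) (L(τ (i + 1)) - L(τ i))`. -/
def riemannSum {Ω : Type*} {d m : ℕ} (g : ℝ → Matrix (Fin d) (Fin m) ℂ)
    (L : ℝ → Ω → (Fin m → ℝ)) (n : ℕ) (τ : ℕ → ℝ) (ω : Ω) : Fin d → ℂ :=
  ∑ i ∈ Finset.range n, g (τ i) *ᵥ fun c => ((L (τ (i + 1)) ω c - L (τ i) ω c : ℝ) : ℂ)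

/-- `I` is (a version of) `∫_s^t g(u) dL(u)`, for a continuous deterministic `g`: the limit in
probability of the Riemann sums along every sequence of partitions of `[s, t]` whose mesh tends
to zero. -/
def IsIntegralOn {Ω : Type*} [MeasurableSpace Ω] {d m : ℕ} (μ : Measure Ω)
    (g : ℝ → Matrix (Fin d) (Fin m) ℂ) (L : ℝ → Ω → (Fin m → ℝ)) (s t : ℝ)
    (I : Ω → (Fin d → ℂ)) : Prop :=
  AEMeasurable I μ ∧
    ∀ (N : ℕ → ℕ) (τ : ℕ → ℕ → ℝ), (∀ n, IsPartition s t (N n) (τ n)) →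
      (∀ δ > 0, ∀ᶠ n in atTop, ∀ i < N n, τ n (i + 1) - τ n i < δ) →
      TendstoInMeasure μ (fun n => riemannSum g L (N n) (τ n)) atTop I

/-- `I` is (a version of) `∫_{-∞}^t g(u) dL(u)`: the limit in probability of `∫_s^t g(u) dL(u)`
as `s → -∞`. -/
def IsIntegralFromBot {Ω : Type*} [MeasurableSpace Ω] {d m : ℕ} (μ : Measure Ω)
    (g : ℝ → Matrix (Fin d) (Fin m) ℂ) (L : ℝ → Ω → (Fin m → ℝ)) (t : ℝ)
    (I : Ω → (Fin d → ℂ)) : Prop :=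
  AEMeasurable I μ ∧ ∃ J : ℝ → Ω → (Fin d → ℂ),
    (∀ s ≤ t, IsIntegralOn μ g L s t (J s)) ∧ TendstoInMeasure μ J atBot I

open Classical in
/-- The stochastic integral `∫_{-∞}^t g(u) dL(u)`, determined up to almost sure equality
(and `0` if it does not exist). -/
def integralFromBot {Ω : Type*} [MeasurableSpace Ω] {d m : ℕ} (μ : Measure Ω)
    (g : ℝ → Matrix (Fin d) (Fin m) ℂ) (L : ℝ → Ω → (Fin m → ℝ)) (t : ℝ) : Ω → (Fin d → ℂ) :=
  if h : ∃ I, IsIntegralFromBot μ g L t I then h.choose else 0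

/-- The Ornstein-Uhlenbeck process `∫_{-∞}^t e^{R (t - u)} N dL(u)`. -/
def ouProcess {Ω : Type*} [MeasurableSpace Ω] {d m : ℕ} (μ : Measure Ω)
    (R : Matrix (Fin d) (Fin d) ℂ) (N : Matrix (Fin d) (Fin m) ℂ)
    (L : ℝ → Ω → (Fin m → ℝ)) (t : ℝ) : Ω → (Fin d → ℂ) :=
  integralFromBot μ (fun u => NormedSpace.exp ((t - u) • R) * N) L t

/-! ### Covariances -/

/-- The matrix `Cov(U, V) = E[(U - E U) (V - E V)ᴴ]` of complex random vectors. -/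
def crossCov {Ω : Type*} [MeasurableSpace Ω] {d : ℕ} (μ : Measure Ω) (U V : Ω → (Fin d → ℂ)) :
    Matrix (Fin d) (Fin d) ℂ :=
  Matrix.of fun a b =>
    ∫ ω, (U ω a - ∫ ω', U ω' a ∂μ) * star (V ω b - ∫ ω', V ω' b ∂μ) ∂μ

/-- The covariance matrix of a real random vector, regarded as a complex matrix. -/
def covMatrix {Ω : Type*} [MeasurableSpace Ω] {m : ℕ} (μ : Measure Ω) (U : Ω → (Fin m → ℝ)) :
    Matrix (Fin m) (Fin m) ℂ :=
  Matrix.of fun a b => ((covariance (fun ω => U ω a) (fun ω => U ω b) μ : ℝ) : ℂ)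

/-- `e^{u R} N S N'ᴴ e^{u R'ᴴ}`. -/
def covIntegrand {d m : ℕ} (S : Matrix (Fin m) (Fin m) ℂ) (R : Matrix (Fin d) (Fin d) ℂ)
    (N : Matrix (Fin d) (Fin m) ℂ) (R' : Matrix (Fin d) (Fin d) ℂ)
    (N' : Matrix (Fin d) (Fin m) ℂ) (u : ℝ) : Matrix (Fin d) (Fin d) ℂ :=
  NormedSpace.exp (u • R) * N * S * N'ᴴ * NormedSpace.exp (u • R'ᴴ)

/-- The entrywise integral `∫_0^∞ G(u) du` of a matrix-valued function. -/
def integralIoi {d : ℕ} (G : ℝ → Matrix (Fin d) (Fin d) ℂ) : Matrix (Fin d) (Fin d) ℂ :=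
  Matrix.of fun a b => ∫ u in Set.Ioi (0 : ℝ), G u a b

end

end MCARMA

namespace MCARMA

noncomputable section

open scoped InnerProductSpace

section

/-! ### Step functions in `L²(ℝ)` -/

/-! Everything takes place in two Hilbert spaces. Since `L` has centred, square integrable,
independent stationary increments, the components of `L t - L 0` have in `L²(Ω)` the Gram matrix
`Σ_L` times that of the signed step functions `stepLp t` in `L²(ℝ)`. Hence sending steps to
increments of component `c` extends to a bounded operator `wienerMap` from `L²(ℝ)` to `L²(Ω)`, and
`inner_wienerMap` is the Itô isometry between components `c` and `c'`, with constant `Σ_L c c'`.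

Riemann sums of a continuous kernel are images of step functions that converge in `L²(ℝ)`, and so do
truncations to `(s, t]` as `s → -∞`. As `L²` convergence implies convergence in probability, the
integrals defined by limits in probability agree almost surely with `wienerMap` (`ouProcess_ae_eq`).

The covariance is now an inner product of kernels in `L²(ℝ)`. The substitution `v = t - u` removes
`t`, and `e^{(l+v)R} = e^{lR} e^{vR}` pulls out `e^{lR_i}` (`inner_ouSumLp`). Square integrability
comes from the exponential decay of `e^{uR_k}`, because the eigenvalues of `R_k` are zeros of `det
A` and so lie in the left half-plane. -/

lemma memLp_indicator_Iic_sub (t : ℝ) :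
    MemLp (fun u => (Set.Iic t).indicator (1 : ℝ → ℂ) u - (Set.Iic 0).indicator (1 : ℝ → ℂ) u) 2
      volume := by
  have h : MemLp ((Set.Icc (-|t|) |t|).indicator (1 : ℝ → ℂ)) 2 volume :=
    memLp_indicator_const 2 measurableSet_Icc (1 : ℂ) (Or.inr (by simp))
  refine h.mono (Measurable.aestronglyMeasurable ?_) (ae_of_all _ fun u => ?_)
  · exact (measurable_one.indicator measurableSet_Iic).sub
      (measurable_one.indicator measurableSet_Iic)
  · have h1 := neg_abs_le t
    have h2 := le_abs_self t
    have h3 := abs_nonneg t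
    simp only [Set.indicator_apply, Set.mem_Iic, Set.mem_Icc, Pi.one_apply]
    split_ifs <;> simp <;> grind

/-- The signed indicator function of the interval between `0` and `t`. -/
def stepLp (t : ℝ) : Lp ℂ 2 (volume : Measure ℝ) := (memLp_indicator_Iic_sub t).toLp

lemma stepLp_zero : stepLp 0 = 0 := by
  rw [stepLp, Lp.eq_zero_iff_ae_eq_zero]
  filter_upwards [(memLp_indicator_Iic_sub 0).coeFn_toLp] with u hu
  simpa using hu

lemma stepLp_sub {s t : ℝ} (hst : s ≤ t) :
    stepLp t - stepLp s =
      indicatorConstLp 2 (measurableSet_Ioc (a := s) (b := t)) (by simp) (1 : ℂ) := by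
  apply Lp.ext
  filter_upwards [(memLp_indicator_Iic_sub s).coeFn_toLp, (memLp_indicator_Iic_sub t).coeFn_toLp,
    Lp.coeFn_sub (stepLp t) (stepLp s), indicatorConstLp_coeFn (p := 2) (hs := measurableSet_Ioc)
      (hμs := (by simp : volume (Set.Ioc s t) ≠ ⊤)) (c := (1 : ℂ))] with u h1 h2 h3 h4
  rw [h3, Pi.sub_apply, stepLp, stepLp, h1, h2, h4]
  simp only [Set.indicator_apply, Set.mem_Iic, Set.mem_Ioc, Pi.one_apply]
  grind

/-- A function orthogonal to all steps has zero integral over every interval with endpoint `0`, so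
Lebesgue differentiation makes it vanish almost everywhere. -/
lemma dense_span_stepLp :
    DenseRange (Finsupp.linearCombination ℂ stepLp) := by
  have h : (LinearMap.range (Finsupp.linearCombination ℂ stepLp)).topologicalClosure = ⊤ := by
    rw [Submodule.topologicalClosure_eq_top_iff, Submodule.eq_bot_iff]
    intro f hf
    rw [Submodule.mem_orthogonal] at hf
    have hs : ∀ t, ⟪stepLp t, f⟫_ℂ = 0 := fun t =>
      hf _ ⟨Finsupp.single t 1, by simp⟩
    have hloc : LocallyIntegrable f volume := (Lp.memLp f).locallyIntegrable (by norm_num)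
    have hI : ∀ t, 0 ≤ t → ∫ x in (0 : ℝ)..t, f x = 0 := by
      intro t ht
      have := L2.inner_indicatorConstLp_one (𝕜 := ℂ) (measurableSet_Ioc (a := 0) (b := t))
        (by simp) f
      rw [← stepLp_sub ht, inner_sub_left, hs, hs] at this
      rw [intervalIntegral.integral_of_le ht, ← this, sub_zero]
    have hI' : ∀ t, t ≤ 0 → ∫ x in (0 : ℝ)..t, f x = 0 := by
      intro t ht
      have := L2.inner_indicatorConstLp_one (𝕜 := ℂ) (measurableSet_Ioc (a := t) (b := 0))
        (by simp) f
      rw [← stepLp_sub ht, inner_sub_left, hs, hs] at this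
      rw [intervalIntegral.integral_of_ge ht, ← this, sub_zero, neg_zero]
    have h0 : (fun t => ∫ x in (0 : ℝ)..t, f x) = fun _ => 0 := by
      funext t
      rcases le_total 0 t with h | h
      · exact hI t h
      · exact hI' t h
    rw [Lp.eq_zero_iff_ae_eq_zero]
    filter_upwards [LocallyIntegrable.ae_hasDerivAt_integral hloc] with x hx
    have h1 := hx 0
    rw [h0] at h1
    exact h1.unique (hasDerivAt_const x 0)
  intro x
  have := Submodule.mem_top (R := ℂ) (x := x)
  rw [← h, ← SetLike.mem_coe, Submodule.topologicalClosure_coe] at this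
  exact this

/-! ### Integration of deterministic functions against a process with orthogonal increments -/

variable {H : Type*} [NormedAddCommGroup H] [InnerProductSpace ℂ H]

lemma inner_linearCombination_eq {v v' : ℝ → H} {c : ℂ}
    (h : ∀ s t, ⟪v s, v' t⟫_ℂ = c * ⟪stepLp s, stepLp t⟫_ℂ) (x y : ℝ →₀ ℂ) :
    ⟪Finsupp.linearCombination ℂ v x, Finsupp.linearCombination ℂ v' y⟫_ℂ =
      c * ⟪Finsupp.linearCombination ℂ stepLp x, Finsupp.linearCombination ℂ stepLp y⟫_ℂ := by
  simp only [Finsupp.linearCombination_apply, Finsupp.sum, sum_inner, inner_sum, inner_smul_left,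
    inner_smul_right, h, Finset.mul_sum]
  refine Finset.sum_congr rfl fun i _ => Finset.sum_congr rfl fun j _ => ?_
  ring

variable [CompleteSpace H]

/-- The integral `f ↦ ∫ f dv` of deterministic functions against a Hilbert space valued process `v`
with orthogonal increments. -/
def wienerMap (v : ℝ → H) : Lp ℂ 2 (volume : Measure ℝ) →L[ℂ] H :=
  (Finsupp.linearCombination ℂ v).extendOfNorm (Finsupp.linearCombination ℂ stepLp)

/-- Proportional Gram matrices give `‖∑ xᵢ v(tᵢ)‖ = √‖c‖ ‖∑ xᵢ stepLp(tᵢ)‖`, the bound under which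
`extendOfNorm` is a genuine extension. -/
lemma wienerMap_linearCombination {v : ℝ → H} {c : ℂ}
    (h : ∀ s t, ⟪v s, v t⟫_ℂ = c * ⟪stepLp s, stepLp t⟫_ℂ) (x : ℝ →₀ ℂ) :
    wienerMap v (Finsupp.linearCombination ℂ stepLp x) = Finsupp.linearCombination ℂ v x := by
  refine LinearMap.extendOfNorm_eq dense_span_stepLp ⟨√‖c‖, fun x => ?_⟩ x
  have h1 := congrArg norm (inner_linearCombination_eq h x x)
  rw [norm_mul, inner_self_eq_norm_sq_to_K, inner_self_eq_norm_sq_to_K] at h1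
  simp only [norm_pow, RCLike.norm_ofReal, abs_norm] at h1
  rw [← Real.sqrt_sq (norm_nonneg (Finsupp.linearCombination ℂ v x)), h1,
    Real.sqrt_mul (norm_nonneg _), Real.sqrt_sq (norm_nonneg _)]

lemma wienerMap_stepLp {v : ℝ → H} {c : ℂ}
    (h : ∀ s t, ⟪v s, v t⟫_ℂ = c * ⟪stepLp s, stepLp t⟫_ℂ) (t : ℝ) :
    wienerMap v (stepLp t) = v t := by
  simpa using wienerMap_linearCombination h (Finsupp.single t 1)

/-- Polarised Itô isometry: two processes are allowed because different components of `L` may be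
correlated. Both sides are continuous, so steps suffice. -/
lemma inner_wienerMap {v v' : ℝ → H} {a a' c : ℂ}
    (hv : ∀ s t, ⟪v s, v t⟫_ℂ = a * ⟪stepLp s, stepLp t⟫_ℂ)
    (hv' : ∀ s t, ⟪v' s, v' t⟫_ℂ = a' * ⟪stepLp s, stepLp t⟫_ℂ)
    (h : ∀ s t, ⟪v s, v' t⟫_ℂ = c * ⟪stepLp s, stepLp t⟫_ℂ)
    (f g : Lp ℂ 2 (volume : Measure ℝ)) :
    ⟪wienerMap v f, wienerMap v' g⟫_ℂ = c * ⟪f, g⟫_ℂ := by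
  refine dense_span_stepLp.induction_on₂ (p := fun f g =>
    ⟪wienerMap v f, wienerMap v' g⟫_ℂ = c * ⟪f, g⟫_ℂ) ?_ ?_ f g
  · exact isClosed_eq (by fun_prop) (by fun_prop)
  · intro x y
    rw [wienerMap_linearCombination hv, wienerMap_linearCombination hv',
      inner_linearCombination_eq h]

/-- With `w` the constant `1`, this says that stochastic integrals are centred. -/
lemma inner_wienerMap_eq_zero {v : ℝ → H} {a : ℂ} {w : H}
    (hv : ∀ s t, ⟪v s, v t⟫_ℂ = a * ⟪stepLp s, stepLp t⟫_ℂ) (hw : ∀ t, ⟪w, v t⟫_ℂ = 0)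
    (f : Lp ℂ 2 (volume : Measure ℝ)) : ⟪w, wienerMap v f⟫_ℂ = 0 := by
  refine dense_span_stepLp.induction_on (p := fun f => ⟪w, wienerMap v f⟫_ℂ = 0) f ?_ ?_
  · exact isClosed_eq (by fun_prop) (by fun_prop)
  · intro x
    rw [wienerMap_linearCombination hv]
    simp [Finsupp.linearCombination_apply, Finsupp.sum, hw]

/-! ### Gram matrices of processes with orthogonal increments -/

/-- The number `(|s| + |t| - |s - t|) / 2` is the length of the overlap of the intervals from `0` to
`s` and from `0` to `t`. Splitting the longer interval at the end of the shorter one leaves only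
this overlap. The formula serves both for `stepLp` and for `L`, which makes their Gram matrices
proportional. -/
lemma inner_eq_of_orthogonal_increments {E : Type*} [NormedAddCommGroup E] [InnerProductSpace ℂ E]
    {v v' : ℝ → E} {c : ℂ} (h0 : v 0 = 0) (h0' : v' 0 = 0)
    (ho : ∀ r s t, r ≤ s → s ≤ t → ⟪v s - v r, v' t - v' s⟫_ℂ = 0)
    (ho' : ∀ r s t, r ≤ s → s ≤ t → ⟪v t - v s, v' s - v' r⟫_ℂ = 0)
    (hc : ∀ s t, s ≤ t → ⟪v t - v s, v' t - v' s⟫_ℂ = c * ((t - s : ℝ) : ℂ)) (s t : ℝ) :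
    ⟪v s, v' t⟫_ℂ = c * (((|s| + |t| - |s - t|) / 2 : ℝ) : ℂ) := by
  rcases le_total 0 s with hs | hs <;> rcases le_total 0 t with ht | ht
  · rcases le_total s t with hst | hst
    · have h1 := ho 0 s t hs hst
      have h2 := hc 0 s hs
      rw [h0, sub_zero, inner_sub_right] at h1
      rw [h0, h0', sub_zero, sub_zero] at h2
      rw [sub_eq_zero.mp h1, h2, abs_of_nonneg hs, abs_of_nonneg ht,
        abs_of_nonpos (sub_nonpos.mpr hst)]
      congr 2; ring
    · have h1 := ho' 0 t s ht hst
      have h2 := hc 0 t ht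
      rw [h0', sub_zero, inner_sub_left] at h1
      rw [h0, h0', sub_zero, sub_zero] at h2
      rw [sub_eq_zero.mp h1, h2, abs_of_nonneg hs, abs_of_nonneg ht,
        abs_of_nonneg (sub_nonneg.mpr hst)]
      congr 2; ring
  · have h1 := ho' t 0 s ht hs
    simp only [h0, h0', sub_zero, zero_sub, inner_neg_right, neg_eq_zero] at h1
    rw [h1, abs_of_nonneg hs, abs_of_nonpos ht, abs_of_nonneg (by linarith)]
    simp
  · have h1 := ho s 0 t hs ht
    simp only [h0, h0', sub_zero, zero_sub, inner_neg_left, neg_eq_zero] at h1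
    rw [h1, abs_of_nonpos hs, abs_of_nonneg ht, abs_of_nonpos (by linarith)]
    simp [neg_add_eq_sub]
  · rcases le_total s t with hst | hst
    · have h1 := ho s t 0 hst ht
      have h2 := hc t 0 ht
      simp only [h0', zero_sub, inner_neg_right, neg_eq_zero, inner_sub_left] at h1
      simp only [h0, h0', zero_sub, inner_neg_right, inner_neg_left, neg_neg] at h2
      rw [← sub_eq_zero.mp h1, h2, abs_of_nonpos hs, abs_of_nonpos ht,
        abs_of_nonpos (sub_nonpos.mpr hst)]
      congr 2; ring
    · have h1 := ho' t s 0 hst hs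
      have h2 := hc s 0 hs
      simp only [h0, zero_sub, inner_neg_left, inner_sub_right, neg_sub_neg] at h1
      simp only [h0, h0', zero_sub, inner_neg_right, inner_neg_left, neg_neg] at h2
      rw [sub_eq_zero.mp h1, h2, abs_of_nonpos hs, abs_of_nonpos ht,
        abs_of_nonneg (sub_nonneg.mpr hst)]
      congr 2; ring

lemma inner_stepLp (s t : ℝ) :
    ⟪stepLp s, stepLp t⟫_ℂ = (((|s| + |t| - |s - t|) / 2 : ℝ) : ℂ) := by
  have hd : ∀ r s t : ℝ, Set.Ioc r s ∩ Set.Ioc s t = ∅ := fun r s t =>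
    Set.disjoint_iff_inter_eq_empty.mp (Set.Ioc_disjoint_Ioc_of_le le_rfl)
  have := inner_eq_of_orthogonal_increments (v := stepLp) (v' := stepLp) (c := 1) stepLp_zero
    stepLp_zero (fun r s t hrs hst => ?_) (fun r s t hrs hst => ?_) (fun s t hst => ?_) s t
  · rw [this, one_mul]
  · rw [stepLp_sub hrs, stepLp_sub hst, L2.inner_indicatorConstLp_indicatorConstLp measurableSet_Ioc
      measurableSet_Ioc (by simp) (by simp)]
    simp [hd]
  · rw [stepLp_sub hrs, stepLp_sub hst, L2.inner_indicatorConstLp_indicatorConstLp measurableSet_Ioc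
      measurableSet_Ioc (by simp) (by simp),
      Set.inter_comm]
    simp [hd]
  · rw [stepLp_sub hst, L2.inner_indicatorConstLp_indicatorConstLp measurableSet_Ioc
      measurableSet_Ioc (by simp) (by simp)]
    simp [hst]

end

section

/-! ### Riemann sums of continuous functions in `L²(ℝ)` -/

lemma IsPartition.le {s t : ℝ} {n : ℕ} {τ : ℕ → ℝ} (h : IsPartition s t n τ) {k : ℕ}
    (hk : k ≤ n) : s ≤ τ k := by
  induction k with
  | zero => exact h.1.ge
  | succ k ih => exact (ih (by omega)).trans (h.2.2 k (by omega))

lemma IsPartition.le_right {s t : ℝ} {n : ℕ} {τ : ℕ → ℝ} (h : IsPartition s t n τ) {k : ℕ}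
    (hk : k ≤ n) : τ k ≤ t := by
  induction hk using Nat.decreasingInduction with
  | self => exact h.2.1.le
  | of_succ k hk ih => exact (h.2.2 k hk).trans ih

lemma IsPartition.sum_indicator {s t : ℝ} {n : ℕ} {τ : ℕ → ℝ} (h : IsPartition s t n τ) (u : ℝ) :
    ∑ i ∈ Finset.range n, (Set.Ioc (τ i) (τ (i + 1))).indicator (1 : ℝ → ℝ) u =
      (Set.Ioc s t).indicator (1 : ℝ → ℝ) u := by
  have key : ∀ k ≤ n, ∑ i ∈ Finset.range k, (Set.Ioc (τ i) (τ (i + 1))).indicator (1 : ℝ → ℝ) u =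
      (Set.Ioc s (τ k)).indicator (1 : ℝ → ℝ) u := by
    intro k
    induction k with
    | zero => intro _; simp [h.1]
    | succ k ih =>
      intro hk
      rw [Finset.sum_range_succ, ih (by omega)]
      have h1 := h.2.2 k (by omega)
      have h2 := h.le (k := k) (by omega)
      simp only [Set.indicator_apply, Set.mem_Ioc, Pi.one_apply]
      grind
  rw [key n le_rfl, h.2.1]

lemma memLp_indicator_Ioc {f : ℝ → ℂ} (hf : Continuous f) (s t : ℝ) :
    MemLp ((Set.Ioc s t).indicator f) 2 volume := by
  rw [memLp_indicator_iff_restrict measurableSet_Ioc]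
  obtain ⟨C, hC⟩ := isCompact_Icc.exists_bound_of_continuousOn (hf.continuousOn (s := Set.Icc s t))
  have h : MemLp f 2 (volume.restrict (Set.Icc s t)) :=
    MemLp.of_bound hf.aestronglyMeasurable C ((ae_restrict_mem measurableSet_Icc).mono hC)
  exact h.mono_measure (Measure.restrict_mono Set.Ioc_subset_Icc_self le_rfl)

/-- The Riemann sum `∑_{i < n} f(τ i) (v(τ (i + 1)) - v(τ i))`. -/
def vecRiemannSum {H : Type*} [AddCommGroup H] [Module ℂ H] (f : ℝ → ℂ) (v : ℝ → H) (n : ℕ)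
    (τ : ℕ → ℝ) : H :=
  ∑ i ∈ Finset.range n, f (τ i) • (v (τ (i + 1)) - v (τ i))

lemma coeFn_vecRiemannSum_stepLp (f : ℝ → ℂ) {s t : ℝ} {n : ℕ} {τ : ℕ → ℝ}
    (h : IsPartition s t n τ) :
    (vecRiemannSum f stepLp n τ : Lp ℂ 2 volume) =ᵐ[volume] fun u =>
      ∑ i ∈ Finset.range n, f (τ i) * (Set.Ioc (τ i) (τ (i + 1))).indicator (1 : ℝ → ℂ) u := by
  have key : ∀ i ∈ Finset.range n, (f (τ i) • (stepLp (τ (i + 1)) - stepLp (τ i)) : Lp ℂ 2 volume)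
      =ᵐ[volume] fun u => f (τ i) * (Set.Ioc (τ i) (τ (i + 1))).indicator (1 : ℝ → ℂ) u := by
    intro i hi
    rw [stepLp_sub (h.2.2 i (Finset.mem_range.mp hi))]
    filter_upwards [Lp.coeFn_smul (f (τ i)) (indicatorConstLp 2
      (measurableSet_Ioc (a := τ i) (b := τ (i + 1))) (by simp) (1 : ℂ)),
      indicatorConstLp_coeFn (p := 2) (hs := measurableSet_Ioc)
      (hμs := (by simp : volume (Set.Ioc (τ i) (τ (i + 1))) ≠ ⊤)) (c := (1 : ℂ))] with u h1 h2
    rw [h1, Pi.smul_apply, h2, smul_eq_mul]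
    rfl
  have h2 : ∀ᵐ u ∂(volume : Measure ℝ), ∀ i ∈ Finset.range n,
      (f (τ i) • (stepLp (τ (i + 1)) - stepLp (τ i)) : Lp ℂ 2 volume) u =
        f (τ i) * (Set.Ioc (τ i) (τ (i + 1))).indicator (1 : ℝ → ℂ) u := by
    rw [Finset.eventually_all]
    exact key
  filter_upwards [h2, Lp.coeFn_finsetSum (Finset.range n)
    (fun i => (f (τ i) • (stepLp (τ (i + 1)) - stepLp (τ i)) : Lp ℂ 2 volume))] with u h3 h4
  rw [vecRiemannSum, h4, Finset.sum_apply]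
  exact Finset.sum_congr rfl h3

/-- By uniform continuity on `[s, t]`, the step function differs from `f` pointwise by at most a
small multiple of the indicator of `(s, t]`. -/
lemma tendsto_vecRiemannSum_stepLp {f : ℝ → ℂ} (hf : Continuous f) {s t : ℝ} {N : ℕ → ℕ}
    {τ : ℕ → ℕ → ℝ} (hτ : ∀ n, IsPartition s t (N n) (τ n))
    (hmesh : ∀ δ > 0, ∀ᶠ n in atTop, ∀ i < N n, τ n (i + 1) - τ n i < δ) :
    Tendsto (fun n => vecRiemannSum f stepLp (N n) (τ n)) atTop
      (𝓝 (memLp_indicator_Ioc hf s t).toLp) := by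
  rw [tendsto_iff_norm_sub_tendsto_zero]
  set K : ℝ := ‖indicatorConstLp 2 (measurableSet_Ioc (a := s) (b := t))
    (by simp : volume (Set.Ioc s t) ≠ ⊤) (1 : ℝ)‖ with hK
  have huc : UniformContinuousOn f (Set.Icc s t) :=
    isCompact_Icc.uniformContinuousOn_of_continuous hf.continuousOn
  rw [Metric.uniformContinuousOn_iff] at huc
  rw [Metric.tendsto_nhds]
  intro ε hε
  have hK0 : 0 ≤ K := norm_nonneg _
  -- `K + 1` rather than `K`, since `K = 0` when the interval is empty.
  obtain ⟨δ, hδ, hδ'⟩ := huc (ε / (K + 1)) (by positivity)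
  filter_upwards [hmesh δ hδ] with n hn
  rw [dist_zero_right, norm_norm]
  refine lt_of_le_of_lt (Lp.norm_le_mul_norm_of_ae_le_mul (c := ε / (K + 1))
    (g := indicatorConstLp 2 (measurableSet_Ioc (a := s) (b := t))
      (by simp : volume (Set.Ioc s t) ≠ ⊤) (1 : ℝ)) ?_) ?_
  · filter_upwards [coeFn_vecRiemannSum_stepLp f (hτ n), (memLp_indicator_Ioc hf s t).coeFn_toLp,
      Lp.coeFn_sub (vecRiemannSum f stepLp (N n) (τ n)) (memLp_indicator_Ioc hf s t).toLp,
      indicatorConstLp_coeFn (p := 2) (hs := measurableSet_Ioc)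
      (hμs := (by simp : volume (Set.Ioc s t) ≠ ⊤)) (c := (1 : ℝ))] with u h1 h2 h3 h4
    rw [h3, Pi.sub_apply, h1, h2, h4]
    have h5 := (hτ n).sum_indicator u
    have h6 : (Set.Ioc s t).indicator f u = ∑ i ∈ Finset.range (N n),
        f u * (Set.Ioc (τ n i) (τ n (i + 1))).indicator (1 : ℝ → ℂ) u := by
      have h7 := congrArg (fun x : ℝ => (x : ℂ)) h5
      rw [← Finset.mul_sum]
      simp only [Set.indicator_apply, Pi.one_apply] at h7 ⊢
      simp only [apply_ite Complex.ofReal, Complex.ofReal_one, Complex.ofReal_zero,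
        Complex.ofReal_sum] at h7
      rw [h7]
      simp
    have h7 : ((Set.Ioc s t).indicator (fun _ => (1 : ℝ)) u) =
        (Set.Ioc s t).indicator (1 : ℝ → ℝ) u := rfl
    have h8 : 0 ≤ (Set.Ioc s t).indicator (1 : ℝ → ℝ) u :=
      Set.indicator_nonneg (fun _ _ => zero_le_one) _
    rw [h6, ← Finset.sum_sub_distrib, h7, Real.norm_of_nonneg h8, ← h5, Finset.mul_sum]
    refine norm_sum_le_of_le _ fun i hi => ?_
    rw [Finset.mem_range] at hi
    simp only [Set.indicator_apply, Pi.one_apply]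
    split_ifs with hu
    · rw [mul_one, mul_one, mul_one, ← dist_eq_norm]
      have a1 := (hτ n).le (k := i) hi.le
      have a2 := (hτ n).le_right (k := i + 1) hi
      have a3 := hn i hi
      refine (hδ' _ ⟨a1, (hτ n).le_right hi.le⟩ _ ⟨by linarith [hu.1], by linarith [hu.2]⟩ ?_).le
      rw [Real.dist_eq, abs_lt]
      constructor <;> linarith [hu.1, hu.2]
    · simp
  · rw [← hK, div_mul_eq_mul_div, div_lt_iff₀ (by positivity)]
    nlinarith

/-- The truncation error is the tail of an `L²` function on `(-∞, s]`; dominated convergence applies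
to its square. -/
lemma tendsto_indicator_Ioc_atBot {f : ℝ → ℂ} (hf : Continuous f) {t : ℝ}
    (h : MemLp ((Set.Iic t).indicator f) 2 volume) :
    Tendsto (fun s => (memLp_indicator_Ioc hf s t).toLp) atBot (𝓝 h.toLp) := by
  rw [Lp.tendsto_Lp_iff_tendsto_eLpNorm'']
  have h2 : ∀ s, (Set.Ioc s t).indicator f - (Set.Iic t).indicator f =
      fun u => - (Set.Iic s).indicator ((Set.Iic t).indicator f) u := by
    intro s
    funext u
    simp only [Set.indicator_apply, Set.mem_Iic, Set.mem_Ioc, Pi.sub_apply]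
    grind
  have h3 : ∀ s, eLpNorm ((Set.Ioc s t).indicator f - (Set.Iic t).indicator f) 2 volume =
      (∫⁻ u, (Set.Iic s).indicator (fun u => ‖(Set.Iic t).indicator f u‖ₑ ^ (2 : ℝ)) u)
        ^ (1 / (2 : ℝ)) := by
    intro s
    rw [h2, eLpNorm_eq_lintegral_rpow_enorm_toReal (by norm_num) (by norm_num)]
    simp only [ENNReal.toReal_ofNat]
    congr 1
    refine lintegral_congr fun u => ?_
    by_cases hu : u ∈ Set.Iic s
    · simp [hu]
    · simp [hu]
  simp_rw [h3]
  have hfin : ∫⁻ u, ‖(Set.Iic t).indicator f u‖ₑ ^ (2 : ℝ) ≠ ⊤ := by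
    have := (lintegral_rpow_enorm_lt_top_of_eLpNorm_lt_top (p := 2) (by norm_num) (by norm_num)
      h.eLpNorm_lt_top)
    simpa using this.ne
  have hm : Measurable fun u => ‖(Set.Iic t).indicator f u‖ₑ ^ (2 : ℝ) :=
    ((hf.measurable.indicator measurableSet_Iic).enorm).pow_const _
  have h4 : Tendsto (fun s => ∫⁻ u, (Set.Iic s).indicator
      (fun u => ‖(Set.Iic t).indicator f u‖ₑ ^ (2 : ℝ)) u) atBot (𝓝 (∫⁻ u : ℝ, 0)) := by
    refine tendsto_lintegral_filter_of_dominated_convergence _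
      (Eventually.of_forall fun s => hm.indicator measurableSet_Iic)
      (Eventually.of_forall fun s => ae_of_all _ fun u => Set.indicator_le_self _ _ _) hfin
      (ae_of_all _ fun u => ?_)
    refine tendsto_const_nhds.congr' ?_
    filter_upwards [eventually_lt_atBot u] with s hs
    simp [hs]
  rw [lintegral_zero] at h4
  have h5 := (ENNReal.continuous_rpow_const (y := 1 / (2 : ℝ))).tendsto 0
  rw [ENNReal.zero_rpow_of_pos (by norm_num)] at h5
  exact h5.comp h4

end

section

/-! ### The stochastic integral as an element of `L²` -/

section

variable {Ω : Type*} [MeasurableSpace Ω] {μ : Measure Ω} {d m : ℕ}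

/-- The square integrable random vector with given square integrable components. -/
def vecLp (f : Fin d → Lp ℂ 2 μ) : Lp (Fin d → ℂ) 2 μ :=
  ∑ a, (ContinuousLinearMap.single ℂ (fun _ : Fin d => ℂ) a).compLpL 2 μ (f a)

lemma continuous_vecLp : Continuous (vecLp : (Fin d → Lp ℂ 2 μ) → Lp (Fin d → ℂ) 2 μ) := by
  unfold vecLp
  fun_prop

lemma coeFn_vecLp (f : Fin d → Lp ℂ 2 μ) : vecLp f =ᵐ[μ] fun ω a => f a ω := by
  have h : ∀ᵐ ω ∂μ, ∀ a, (ContinuousLinearMap.single ℂ (fun _ : Fin d => ℂ) a).compLpL 2 μ (f a) ω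
      = Pi.single a (f a ω) := by
    rw [ae_all_iff]
    intro a
    filter_upwards [ContinuousLinearMap.coeFn_compLpL (p := 2)
      (ContinuousLinearMap.single ℂ (fun _ : Fin d => ℂ) a) (f a)] with ω h
    rw [h]
    rfl
  filter_upwards [h, Lp.coeFn_finsetSum Finset.univ (fun a =>
    (ContinuousLinearMap.single ℂ (fun _ : Fin d => ℂ) a).compLpL 2 μ (f a))] with ω h1 h2
  rw [vecLp, h2, Finset.sum_apply]
  simp_rw [h1]
  exact Finset.univ_sum_single fun a => f a ω

lemma map_vecRiemannSum {H H' : Type*} [AddCommGroup H] [Module ℂ H] [AddCommGroup H'] [Module ℂ H']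
    (W : H →ₗ[ℂ] H') (f : ℝ → ℂ) (v : ℝ → H) (n : ℕ) (τ : ℕ → ℝ) :
    W (vecRiemannSum f v n τ) = vecRiemannSum f (fun t => W (v t)) n τ := by
  simp [vecRiemannSum, map_sum]

/-- `X c t` is the component `c` of the increment `L t - L 0`, as an element of `L²`, and the
increments of `X` are stationary and orthogonal, with covariance matrix `S` per unit of time. -/
structure IsSquareIntegrableVersion (μ : Measure Ω) (L : ℝ → Ω → (Fin m → ℝ))
    (X : Fin m → ℝ → Lp ℂ 2 μ) (S : Matrix (Fin m) (Fin m) ℂ) : Prop where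
  ae_eq : ∀ c t, X c t =ᵐ[μ] fun ω => ((L t ω c - L 0 ω c : ℝ) : ℂ)
  gram : ∀ c c' s t, ⟪X c s, X c' t⟫_ℂ = S c c' * ⟪stepLp s, stepLp t⟫_ℂ

/-- The integral of a matrix-valued deterministic function with entries in `L²(ℝ)`. -/
def stochIntegral (X : Fin m → ℝ → Lp ℂ 2 μ)
    (h : Fin d → Fin m → Lp ℂ 2 (volume : Measure ℝ)) : Lp (Fin d → ℂ) 2 μ :=
  vecLp fun a => ∑ c, wienerMap (X c) (h a c)

lemma continuous_stochIntegral (X : Fin m → ℝ → Lp ℂ 2 μ) :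
    Continuous (stochIntegral X :
      (Fin d → Fin m → Lp ℂ 2 (volume : Measure ℝ)) → Lp (Fin d → ℂ) 2 μ) := by
  unfold stochIntegral
  refine continuous_vecLp.comp ?_
  fun_prop

variable {L : ℝ → Ω → (Fin m → ℝ)} {X : Fin m → ℝ → Lp ℂ 2 μ} {S : Matrix (Fin m) (Fin m) ℂ}

/-- This links the Hilbert space picture to the pathwise Riemann sums in the definition of the
integral. -/
lemma stochIntegral_vecRiemannSum (hX : IsSquareIntegrableVersion μ L X S)
    (g : ℝ → Matrix (Fin d) (Fin m) ℂ) (n : ℕ) (τ : ℕ → ℝ) :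
    stochIntegral X (fun a c => vecRiemannSum (fun u => g u a c) stepLp n τ) =ᵐ[μ]
      riemannSum g L n τ := by
  have h1 : ∀ c, ∀ f : ℝ → ℂ, wienerMap (X c) (vecRiemannSum f stepLp n τ) =ᵐ[μ]
      fun ω => ∑ i ∈ Finset.range n, f (τ i) * ((L (τ (i + 1)) ω c - L (τ i) ω c : ℝ) : ℂ) := by
    intro c f
    have h2 : wienerMap (X c) (vecRiemannSum f stepLp n τ) = vecRiemannSum f (X c) n τ := by
      refine (map_vecRiemannSum (wienerMap (X c)).toLinearMap f stepLp n τ).trans ?_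
      congr 1
      funext t
      exact wienerMap_stepLp (hX.gram c c) t
    rw [h2]
    have h3 : ∀ᵐ ω ∂μ, ∀ i, (f (τ i) • (X c (τ (i + 1)) - X c (τ i)) : Lp ℂ 2 μ) ω =
        f (τ i) * ((L (τ (i + 1)) ω c - L (τ i) ω c : ℝ) : ℂ) := by
      rw [ae_all_iff]
      intro i
      filter_upwards [Lp.coeFn_smul (f (τ i)) (X c (τ (i + 1)) - X c (τ i)),
        Lp.coeFn_sub (X c (τ (i + 1))) (X c (τ i)), hX.ae_eq c (τ (i + 1)), hX.ae_eq c (τ i)]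
        with ω e1 e2 e3 e4
      rw [e1, Pi.smul_apply, e2, Pi.sub_apply, e3, e4, smul_eq_mul]
      push_cast
      ring
    filter_upwards [h3, Lp.coeFn_finsetSum (Finset.range n)
      (fun i => (f (τ i) • (X c (τ (i + 1)) - X c (τ i)) : Lp ℂ 2 μ))] with ω e1 e2
    rw [vecRiemannSum, e2, Finset.sum_apply]
    exact Finset.sum_congr rfl fun i _ => e1 i
  have h2 : ∀ᵐ ω ∂μ, ∀ a c,
      wienerMap (X c) (vecRiemannSum (fun u => g u a c) stepLp n τ) ω =
        ∑ i ∈ Finset.range n, g (τ i) a c * ((L (τ (i + 1)) ω c - L (τ i) ω c : ℝ) : ℂ) := by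
    simp_rw [ae_all_iff]
    exact fun a c => h1 c fun u => g u a c
  have h3 : ∀ᵐ ω ∂μ, ∀ a : Fin d,
      (∑ c, wienerMap (X c) (vecRiemannSum (fun u => g u a c) stepLp n τ) : Lp ℂ 2 μ) ω =
      ∑ c, wienerMap (X c) (vecRiemannSum (fun u => g u a c) stepLp n τ) ω := by
    rw [ae_all_iff]
    intro a
    filter_upwards [Lp.coeFn_finsetSum Finset.univ (fun c =>
      wienerMap (X c) (vecRiemannSum (fun u => g u a c) stepLp n τ))] with ω e
    rw [e, Finset.sum_apply]
  filter_upwards [h2, h3, coeFn_vecLp fun a : Fin d =>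
    ∑ c, wienerMap (X c) (vecRiemannSum (fun u => g u a c) stepLp n τ)] with ω e1 e2 e3
  rw [stochIntegral, e3]
  funext a
  rw [e2, riemannSum, Finset.sum_apply]
  simp_rw [e1, Matrix.mulVec, dotProduct]
  exact Finset.sum_comm

lemma isIntegralOn_stochIntegral (hX : IsSquareIntegrableVersion μ L X S)
    {g : ℝ → Matrix (Fin d) (Fin m) ℂ} (hg : ∀ a c, Continuous fun u => g u a c) (s t : ℝ) :
    IsIntegralOn μ g L s t
      (stochIntegral X fun a c => (memLp_indicator_Ioc (hg a c) s t).toLp) := by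
  refine ⟨(Lp.stronglyMeasurable _).measurable.aemeasurable, fun N τ hτ hmesh => ?_⟩
  have h : Tendsto (fun n => stochIntegral X
      (fun a c => vecRiemannSum (fun u => g u a c) stepLp (N n) (τ n))) atTop
      (𝓝 (stochIntegral X fun a c => (memLp_indicator_Ioc (hg a c) s t).toLp)) := by
    refine ((continuous_stochIntegral X).tendsto _).comp ?_
    rw [tendsto_pi_nhds]
    intro a
    rw [tendsto_pi_nhds]
    intro c
    exact tendsto_vecRiemannSum_stepLp (hg a c) hτ hmesh
  exact (tendstoInMeasure_of_tendsto_Lp h).congr_left fun n =>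
    stochIntegral_vecRiemannSum hX g (N n) (τ n)

lemma isIntegralFromBot_stochIntegral (hX : IsSquareIntegrableVersion μ L X S)
    {g : ℝ → Matrix (Fin d) (Fin m) ℂ} (hg : ∀ a c, Continuous fun u => g u a c) {t : ℝ}
    (h2 : ∀ a c, MemLp ((Set.Iic t).indicator fun u => g u a c) 2 volume) :
    IsIntegralFromBot μ g L t (stochIntegral X fun a c => (h2 a c).toLp) := by
  refine ⟨(Lp.stronglyMeasurable _).measurable.aemeasurable, _,
    fun s _ => isIntegralOn_stochIntegral hX hg s t, ?_⟩
  refine tendstoInMeasure_of_tendsto_Lp (((continuous_stochIntegral X).tendsto _).comp ?_)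
  rw [tendsto_pi_nhds]
  intro a
  rw [tendsto_pi_nhds]
  intro c
  exact tendsto_indicator_Ioc_atBot (hg a c) (h2 a c)

end

/-! ### Uniqueness of the stochastic integral -/

lemma exists_partition_mesh_tendsto_zero {s t : ℝ} (hst : s ≤ t) :
    ∃ (N : ℕ → ℕ) (τ : ℕ → ℕ → ℝ), (∀ n, IsPartition s t (N n) (τ n)) ∧
      ∀ δ > 0, ∀ᶠ n in atTop, ∀ i < N n, τ n (i + 1) - τ n i < δ := by
  refine ⟨fun n => n + 1, fun n i => s + i * ((t - s) / (n + 1)), fun n => ⟨by simp, ?_, ?_⟩, ?_⟩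
  · have : (n : ℝ) + 1 ≠ 0 := by positivity
    push_cast
    field_simp
    ring
  · intro i _
    have : 0 ≤ (t - s) / ((n : ℝ) + 1) := div_nonneg (by linarith) (by positivity)
    push_cast
    nlinarith
  · intro δ hδ
    have h : Tendsto (fun n : ℕ => (t - s) / ((n : ℝ) + 1)) atTop (𝓝 0) :=
      tendsto_const_nhds.div_atTop (tendsto_natCast_atTop_atTop.atTop_add tendsto_const_nhds)
    filter_upwards [h.eventually_lt_const hδ] with n hn i _
    push_cast
    linarith

variable {Ω : Type*} [MeasurableSpace Ω] {μ : Measure Ω} {d m : ℕ} {L : ℝ → Ω → (Fin m → ℝ)}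
  {g : ℝ → Matrix (Fin d) (Fin m) ℂ}

lemma IsIntegralOn.ae_eq {s t : ℝ} (hst : s ≤ t) {I I' : Ω → (Fin d → ℂ)}
    (h : IsIntegralOn μ g L s t I) (h' : IsIntegralOn μ g L s t I') : I =ᵐ[μ] I' := by
  obtain ⟨N, τ, h1, h2⟩ := exists_partition_mesh_tendsto_zero hst
  exact tendstoInMeasure_ae_unique (h.2 N τ h1 h2) (h'.2 N τ h1 h2)

lemma IsIntegralFromBot.ae_eq {t : ℝ} {I I' : Ω → (Fin d → ℂ)}
    (h : IsIntegralFromBot μ g L t I) (h' : IsIntegralFromBot μ g L t I') : I =ᵐ[μ] I' := by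
  obtain ⟨-, J, h1, h2⟩ := h
  obtain ⟨-, J', h1', h2'⟩ := h'
  refine tendstoInMeasure_ae_unique h2 (h2'.congr' ?_ .rfl)
  filter_upwards [eventually_le_atBot t] with s hs
  exact (h1' s hs).ae_eq hs (h1 s hs)

/-- The version picked by `choose` is arbitrary, but limits in probability are almost surely unique.
-/
lemma integralFromBot_ae_eq {t : ℝ} {I : Ω → (Fin d → ℂ)} (h : IsIntegralFromBot μ g L t I) :
    integralFromBot μ g L t =ᵐ[μ] I := by
  have h' : ∃ I, IsIntegralFromBot μ g L t I := ⟨I, h⟩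
  rw [integralFromBot, dif_pos h']
  exact h'.choose_spec.ae_eq h

end

/-! ### Additive functions on the half line -/

/-- Cauchy's functional equation: the odd extension of `f` is additive on `ℝ` and continuous at `0`,
hence linear. -/
lemma eq_mul_of_additive_of_tendsto_zero {f : ℝ → ℝ}
    (hadd : ∀ s t, 0 ≤ s → 0 ≤ t → f (s + t) = f s + f t)
    (h0 : Tendsto f (𝓝[>] 0) (𝓝 0)) {t : ℝ} (ht : 0 ≤ t) : f t = t * f 1 := by
  have hf0 : f 0 = 0 := by simpa using hadd 0 0 le_rfl le_rfl
  -- Here `g x = f x⁺ - f x⁻`. Additivity follows from applying `f` to `(x + y)⁺ + x⁻ + y⁻ = (x +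
  -- y)⁻ + x⁺ + y⁺`.
  let g : ℝ →+ ℝ := AddMonoidHom.mk' (fun x => f (max x 0) - f (max (-x) 0)) fun x y => by
    have h1 := hadd (max (x + y) 0) (max (-x) 0 + max (-y) 0) (by positivity) (by positivity)
    have h2 := hadd (max (-(x + y)) 0) (max x 0 + max y 0) (by positivity) (by positivity)
    have h3 : max (x + y) 0 + (max (-x) 0 + max (-y) 0) =
        max (-(x + y)) 0 + (max x 0 + max y 0) := by
      have e : ∀ z : ℝ, max z 0 - max (-z) 0 = z := fun z => by
        rcases le_total 0 z with h | h
        · rw [max_eq_left h, max_eq_right (by linarith)]; ring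
        · rw [max_eq_right h, max_eq_left (by linarith)]; ring
      linarith [e x, e y, e (x + y)]
    rw [h3, h2, hadd _ _ (by positivity) (by positivity),
      hadd (max (-x) 0) _ (by positivity) (by positivity)] at h1
    linarith
  have hg : ∀ x, 0 ≤ x → g x = f x := fun x hx => by
    simp [g, hx, hf0]
  have hg' : ∀ x, x ≤ 0 → g x = - f (-x) := fun x hx => by
    simp [g, hx, hf0]
  have hc : ContinuousAt g 0 := by
    rw [Metric.continuousAt_iff]
    intro ε hε
    rw [Metric.tendsto_nhdsWithin_nhds] at h0
    obtain ⟨δ, hδ, h⟩ := h0 ε hε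
    refine ⟨δ, hδ, fun {x} hx => ?_⟩
    rw [map_zero, dist_zero_right] at *
    rcases lt_trichotomy 0 x with hx0 | hx0 | hx0
    · rw [hg x hx0.le]
      simpa using h (Set.mem_Ioi.mpr hx0) (by simpa using hx)
    · simpa [← hx0] using hε
    · rw [hg' x hx0.le, norm_neg]
      simpa using h (x := -x) (Set.mem_Ioi.mpr (by linarith)) (by simpa using hx)
  have h1 := (g.toRealLinearMap (continuous_of_continuousAt_zero g hc)).map_smul t 1
  simp only [AddMonoidHom.coe_toRealLinearMap, smul_eq_mul, mul_one] at h1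
  rwa [hg t ht, hg 1 zero_le_one] at h1

/-- If `n x ≤ 1`, then `n f(x) ≤ n f(x) + f(1 - n x) = f(1)`, so `f(x) ≤ f(1) / n`. -/
lemma tendsto_zero_of_additive_of_nonneg {f : ℝ → ℝ}
    (hadd : ∀ s t, 0 ≤ s → 0 ≤ t → f (s + t) = f s + f t) (hf : ∀ t, 0 ≤ t → 0 ≤ f t) :
    Tendsto f (𝓝[>] 0) (𝓝 0) := by
  have hn : ∀ (n : ℕ) (x : ℝ), 0 ≤ x → f (n * x) = n * f x := by
    intro n x hx
    induction n with
    | zero => simpa using hadd 0 0 le_rfl le_rfl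
    | succ n ih =>
      push_cast
      rw [add_mul, one_mul, hadd _ _ (by positivity) hx, ih]
      ring
  rw [Metric.tendsto_nhdsWithin_nhds]
  intro ε hε
  obtain ⟨n, hn'⟩ := exists_nat_gt (f 1 / ε)
  have hn0 : (0 : ℝ) < n := lt_of_le_of_lt (div_nonneg (hf 1 zero_le_one) hε.le) hn'
  refine ⟨1 / n, by positivity, fun {x} hx hx' => ?_⟩
  rw [dist_zero_right, Real.norm_of_nonneg (le_of_lt hx)] at hx'
  rw [dist_zero_right, Real.norm_of_nonneg (hf x (le_of_lt hx))]
  have h1 : (n : ℝ) * x ≤ 1 := by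
    rw [lt_div_iff₀ hn0] at hx'
    linarith
  have h2 := hadd (n * x) (1 - n * x) (mul_nonneg hn0.le (le_of_lt hx)) (by linarith)
  rw [add_sub_cancel, hn n x (le_of_lt hx)] at h2
  have h3 := hf (1 - n * x) (by linarith)
  rw [div_lt_iff₀ hε] at hn'
  by_contra hcon
  push Not at hcon
  nlinarith

/-! ### Moments of the increments of a Lévy process -/

/-- By Fubini, `X + y` is square integrable for almost every value `y` of `Y`, and one such `y` is
enough. This passes from unit increments to shorter ones. -/
lemma memLp_two_of_indepFun_add {Ω : Type*} [MeasurableSpace Ω] {μ : Measure Ω}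
    [IsProbabilityMeasure μ] {X Y : Ω → ℝ} (hX : Measurable X) (hY : Measurable Y)
    (h : X ⟂ᵢ[μ] Y) (hXY : MemLp (fun ω => X ω + Y ω) 2 μ) : MemLp X 2 μ := by
  have hp : IsProbabilityMeasure (μ.map X) := Measure.isProbabilityMeasure_map hX.aemeasurable
  have hp' : IsProbabilityMeasure (μ.map Y) := Measure.isProbabilityMeasure_map hY.aemeasurable
  have h1 : Integrable (fun p : ℝ × ℝ => (p.1 + p.2) ^ 2) ((μ.map X).prod (μ.map Y)) := by
    rw [← (indepFun_iff_map_prod_eq_prod_map_map hX.aemeasurable hY.aemeasurable).mp h,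
      integrable_map_measure (by fun_prop) (by fun_prop)]
    exact hXY.integrable_sq
  obtain ⟨y, hy⟩ := h1.prod_left_ae.exists
  have h2 : MemLp (fun x : ℝ => x + y) 2 (μ.map X) := by
    rw [memLp_two_iff_integrable_sq (by fun_prop)]
    exact hy
  have h3 : MemLp (fun x : ℝ => x) 2 (μ.map X) := by
    have := h2.sub (memLp_const y)
    refine this.congr_norm (by fun_prop) (ae_of_all _ fun x => ?_)
    simp
  exact (memLp_map_measure_iff (by fun_prop) hX.aemeasurable).mp h3

namespace IsTwoSidedLevy

variable {Ω : Type*} [MeasurableSpace Ω] {μ : Measure Ω} [IsProbabilityMeasure μ] {m : ℕ}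
  {L : ℝ → Ω → (Fin m → ℝ)}

omit [IsProbabilityMeasure μ] in
lemma measurable_apply (hL : IsTwoSidedLevy L μ) (c : Fin m) (t : ℝ) :
    Measurable fun ω => L t ω c :=
  (measurable_pi_apply c).comp (hL.measurable t)

omit [IsProbabilityMeasure μ] in
lemma measurable_increment (hL : IsTwoSidedLevy L μ) (c : Fin m) (s t : ℝ) :
    Measurable fun ω => L t ω c - L s ω c :=
  (hL.measurable_apply c t).sub (hL.measurable_apply c s)

omit [IsProbabilityMeasure μ] in
lemma indepFun_increment (hL : IsTwoSidedLevy L μ) (c c' : Fin m) {r s t : ℝ} (hrs : r ≤ s)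
    (hst : s ≤ t) :
    (fun ω => L s ω c - L r ω c) ⟂ᵢ[μ] (fun ω => L t ω c' - L s ω c') :=
  (hL.indep.indepFun_sub_sub hrs hst).comp (measurable_pi_apply c) (measurable_pi_apply c')

omit [IsProbabilityMeasure μ] in
lemma identDistrib_increment (hL : IsTwoSidedLevy L μ) (s t : ℝ) :
    IdentDistrib (fun ω => L t ω - L s ω) (fun ω => L (t - s) ω - L 0 ω) μ μ := by
  simpa using hL.stationary 0 (t - s) s

omit [IsProbabilityMeasure μ] in
lemma identDistrib_increment_apply (hL : IsTwoSidedLevy L μ) (c : Fin m) (s t : ℝ) :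
    IdentDistrib (fun ω => L t ω c - L s ω c) (fun ω => L (t - s) ω c - L 0 ω c) μ μ :=
  (hL.identDistrib_increment s t).comp (measurable_pi_apply c)

lemma memLp_increment (hL : IsTwoSidedLevy L μ) (hL2 : MemLp (L 1) 2 μ) (c : Fin m) (s t : ℝ) :
    MemLp (fun ω => L t ω c - L s ω c) 2 μ := by
  have h1 : ∀ s, MemLp (fun ω => L (s + 1) ω c - L s ω c) 2 μ := by
    intro s
    have h := hL.identDistrib_increment_apply c s (s + 1)
    rw [h.memLp_iff, add_sub_cancel_left]
    have h' : MemLp (fun ω => L 1 ω c) 2 μ := hL2.eval c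
    refine h'.ae_eq ?_
    filter_upwards [hL.zero] with ω hω
    simp [hω]
  have h2 : ∀ s t, s ≤ t → t ≤ s + 1 → MemLp (fun ω => L t ω c - L s ω c) 2 μ := by
    intro s t hst hts
    refine memLp_two_of_indepFun_add (hL.measurable_increment c s t)
      (hL.measurable_increment c t (s + 1)) (hL.indepFun_increment c c hst hts) ?_
    simpa using h1 s
  have h3 : ∀ (n : ℕ) (s t : ℝ), s ≤ t → t ≤ s + n → MemLp (fun ω => L t ω c - L s ω c) 2 μ := by
    intro n
    induction n with
    | zero =>
      intro s t hst hts
      obtain rfl : s = t := le_antisymm hst (by simpa using hts)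
      simp
    | succ n ih =>
      intro s t hst hts
      push_cast at hts
      rcases le_total t (s + n) with h | h
      · exact ih s t hst h
      · have := (h2 (s + n) t h (by linarith)).add (ih s (s + n) (by simp) le_rfl)
        refine this.ae_eq (ae_of_all _ fun ω => ?_)
        simp
  have h4 : ∀ s t, s ≤ t → MemLp (fun ω => L t ω c - L s ω c) 2 μ := by
    intro s t hst
    obtain ⟨n, hn⟩ := exists_nat_ge (t - s)
    exact h3 n s t hst (by linarith)
  rcases le_total s t with h | h
  · exact h4 s t h
  · refine (h4 t s h).neg.ae_eq (ae_of_all _ fun ω => ?_)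
    simp

/-- The mean `M` is additive with `M 1 = 0`, so only `M h → 0` as `h ↓ 0` is at stake. The variance
`V` is additive and nonnegative, hence tends to `0`, so `L h - L 0 - M h → 0` in `L²`;
right-continuity gives `L h - L 0 → 0` almost surely. -/
lemma integral_increment (hL : IsTwoSidedLevy L μ) (hL2 : MemLp (L 1) 2 μ)
    (hL0 : ∫ ω, L 1 ω ∂μ = 0) (c : Fin m) (s t : ℝ) :
    ∫ ω, (L t ω c - L s ω c) ∂μ = 0 := by
  have hint : ∀ s t, Integrable (fun ω => L t ω c - L s ω c) μ := fun s t =>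
    (hL.memLp_increment hL2 c s t).integrable (by norm_num)
  set M : ℝ → ℝ := fun h => ∫ ω, (L h ω c - L 0 ω c) ∂μ with hM
  set V : ℝ → ℝ := fun h => Var[fun ω => L h ω c - L 0 ω c; μ] with hV
  have hMi : ∀ s t, ∫ ω, (L t ω c - L s ω c) ∂μ = M (t - s) := fun s t =>
    (hL.identDistrib_increment_apply c s t).integral_eq
  have hVi : ∀ s t, Var[fun ω => L t ω c - L s ω c; μ] = V (t - s) := fun s t =>
    (hL.identDistrib_increment_apply c s t).variance_eq
  have hMadd : ∀ s t, 0 ≤ s → 0 ≤ t → M (s + t) = M s + M t := by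
    intro s t _ _
    have h1 := hMi s (s + t)
    rw [add_sub_cancel_left] at h1
    rw [← h1, hM, ← integral_add (hint _ _) (hint _ _)]
    simp
  have hVadd : ∀ s t, 0 ≤ s → 0 ≤ t → V (s + t) = V s + V t := by
    intro s t hs ht
    have h1 := hVi s (s + t)
    rw [add_sub_cancel_left] at h1
    rw [← h1, hV, ← (hL.indepFun_increment c c hs (by linarith)).variance_fun_add
      (hL.memLp_increment hL2 c _ _) (hL.memLp_increment hL2 c _ _)]
    simp
  have hV0 := tendsto_zero_of_additive_of_nonneg hVadd fun t _ => variance_nonneg _ _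
  have hM0 : Tendsto M (𝓝[>] 0) (𝓝 0) := by
    refine tendsto_of_seq_tendsto fun h hh => ?_
    have e1 : ∀ᵐ ω ∂μ, Tendsto (fun n => L (h n) ω c - L 0 ω c) atTop (𝓝 0) := by
      filter_upwards [hL.cadlag] with ω hω
      have h1 := (hω 0).1
      have h2 : Tendsto h atTop (𝓝[≥] 0) := hh.mono_right (nhdsWithin_mono _ Set.Ioi_subset_Ici_self)
      have h3 := ((continuous_apply c).tendsto _).comp (h1.tendsto.comp h2)
      simpa using h3.sub_const (L 0 ω c)
    have e2 : TendstoInMeasure μ (fun n ω => (L (h n) ω c - L 0 ω c) - M (h n)) atTop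
        fun _ => 0 := by
      refine tendstoInMeasure_of_tendsto_eLpNorm (p := 2) (by norm_num)
        (fun n => ((hL.measurable_increment c 0 (h n)).sub_const _).aestronglyMeasurable)
        aestronglyMeasurable_const ?_
      have e3 : ∀ n, eLpNorm ((fun ω => (L (h n) ω c - L 0 ω c) - M (h n)) - fun _ => 0) 2 μ =
          ENNReal.ofReal (√ (V (h n))) := by
        intro n
        have e4 : MemLp (fun ω => (L (h n) ω c - L 0 ω c) - M (h n)) 2 μ :=
          (hL.memLp_increment hL2 c 0 (h n)).sub (memLp_const _)
        have e5 : ((fun ω => (L (h n) ω c - L 0 ω c) - M (h n)) - fun _ => 0) =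
          fun ω => (L (h n) ω c - L 0 ω c) - M (h n) := by
          funext ω; simp
        rw [e5, e4.eLpNorm_eq_integral_rpow_norm (by norm_num) (by norm_num), Real.sqrt_eq_rpow,
          show V (h n) = Var[fun ω => L (h n) ω c - L 0 ω c; μ] from rfl,
          variance_eq_integral (hL.measurable_increment c 0 (h n)).aemeasurable]
        simp [hM]
      simp_rw [e3]
      have e4 := (ENNReal.continuous_ofReal.comp Real.continuous_sqrt).tendsto 0
      simp only [Function.comp_apply, Real.sqrt_zero, ENNReal.ofReal_zero] at e4
      exact e4.comp (hV0.comp hh)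
    refine tendsto_of_subseq_tendsto fun ns hns => ?_
    obtain ⟨ms, hms, h1⟩ := (e2.comp hns).exists_seq_tendsto_ae
    -- `M` is deterministic, so subtracting the two limits at a single `ω` suffices.
    obtain ⟨ω, h2, h3⟩ := (e1.and h1).exists
    refine ⟨ms, ?_⟩
    simpa using (h2.comp (hns.comp hms.tendsto_atTop)).sub h3
  have hM1 : M 1 = 0 := by
    have h1 : ∫ ω, L 1 ω c ∂μ = 0 := by
      have := eval_integral (μ := μ) (f := L 1) (fun c => (hL2.eval c).integrable (by norm_num)) c
      rw [← this, hL0]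
      rfl
    refine Eq.trans (integral_congr_ae ?_) h1
    filter_upwards [hL.zero] with ω hω
    simp [hω]
  have hMz : ∀ t, 0 ≤ t → M t = 0 := fun t ht => by
    rw [eq_mul_of_additive_of_tendsto_zero hMadd hM0 ht, hM1, mul_zero]
  rcases le_total s t with h | h
  · rw [hMi, hMz _ (by linarith)]
  · have h1 := hMz (s - t) (by linarith)
    rw [← hMi] at h1
    rw [← neg_eq_zero, ← integral_neg, ← h1]
    simp

lemma integral_increment_mul_eq_zero (hL : IsTwoSidedLevy L μ) (hL2 : MemLp (L 1) 2 μ)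
    (hL0 : ∫ ω, L 1 ω ∂μ = 0) (c c' : Fin m) {r s t : ℝ} (hrs : r ≤ s) (hst : s ≤ t) :
    ∫ ω, (L s ω c - L r ω c) * (L t ω c' - L s ω c') ∂μ = 0 := by
  rw [(hL.indepFun_increment c c' hrs hst).integral_fun_mul_eq_mul_integral
    (hL.measurable_increment c r s).aestronglyMeasurable
    (hL.measurable_increment c' s t).aestronglyMeasurable,
    hL.integral_increment hL2 hL0, zero_mul]

/-- Cross terms vanish, so `G c c'` is additive in time. The diagonal is nonnegative, hence tends to
`0`; the off-diagonal part is dominated by it through `|xy| ≤ x² + y²`. -/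
lemma integral_increment_mul_increment (hL : IsTwoSidedLevy L μ) (hL2 : MemLp (L 1) 2 μ)
    (hL0 : ∫ ω, L 1 ω ∂μ = 0) (c c' : Fin m) {s t : ℝ} (hst : s ≤ t) :
    ∫ ω, (L t ω c - L s ω c) * (L t ω c' - L s ω c') ∂μ =
      (t - s) * cov[fun ω => L 1 ω c, fun ω => L 1 ω c'; μ] := by
  have hint : ∀ c c' r s t u, Integrable
      (fun ω => (L s ω c - L r ω c) * (L u ω c' - L t ω c')) μ := fun c c' r s t u =>
    (hL.memLp_increment hL2 c r s).integrable_mul (hL.memLp_increment hL2 c' t u)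
  set G : Fin m → Fin m → ℝ → ℝ :=
    fun c c' h => ∫ ω, (L h ω c - L 0 ω c) * (L h ω c' - L 0 ω c') ∂μ with hG
  have hGi : ∀ c c' s t, ∫ ω, (L t ω c - L s ω c) * (L t ω c' - L s ω c') ∂μ = G c c' (t - s) :=
    fun c c' s t => ((hL.identDistrib_increment s t).comp
      (u := fun x : Fin m → ℝ => x c * x c') (by fun_prop)).integral_eq
  have hGadd : ∀ c c' s t, 0 ≤ s → 0 ≤ t → G c c' (s + t) = G c c' s + G c c' t := by
    intro c c' s t hs ht
    have h1 := hGi c c' s (s + t)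
    rw [add_sub_cancel_left] at h1
    have h2 := hL.integral_increment_mul_eq_zero hL2 hL0 c c' hs (by linarith : s ≤ s + t)
    have h3 := hL.integral_increment_mul_eq_zero hL2 hL0 c' c hs (by linarith : s ≤ s + t)
    have h4 : G c c' (s + t) = (G c c' s + ∫ ω, (L (s + t) ω c - L s ω c) *
          (L (s + t) ω c' - L s ω c') ∂μ) +
        ((∫ ω, (L s ω c - L 0 ω c) * (L (s + t) ω c' - L s ω c') ∂μ) +
        ∫ ω, (L s ω c' - L 0 ω c') * (L (s + t) ω c - L s ω c) ∂μ) := by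
      rw [← integral_add (hint _ _ _ _ _ _) (hint _ _ _ _ _ _),
        ← integral_add (hint _ _ _ _ _ _) (hint _ _ _ _ _ _),
        ← integral_add (by exact (hint _ _ _ _ _ _).add (hint _ _ _ _ _ _))
          (by exact (hint _ _ _ _ _ _).add (hint _ _ _ _ _ _))]
      refine integral_congr_ae (ae_of_all _ fun ω => ?_)
      ring
    rw [h4, h1, h2, h3]
    ring
  have hGd : ∀ c, Tendsto (G c c) (𝓝[>] 0) (𝓝 0) := fun c =>
    tendsto_zero_of_additive_of_nonneg (hGadd c c) fun t _ =>
      integral_nonneg fun ω => mul_self_nonneg _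
  have hG0 : Tendsto (G c c') (𝓝[>] 0) (𝓝 0) := by
    refine squeeze_zero_norm (a := fun h => G c c h + G c' c' h) (fun h => ?_) ?_
    · rw [hG, ← integral_add (hint _ _ _ _ _ _) (hint _ _ _ _ _ _)]
      refine norm_integral_le_of_norm_le ((hint _ _ _ _ _ _).add (hint _ _ _ _ _ _))
        (ae_of_all _ fun ω => ?_)
      rw [Real.norm_eq_abs, abs_le]
      constructor <;> nlinarith [sq_nonneg ((L h ω c - L 0 ω c) + (L h ω c' - L 0 ω c')),
        sq_nonneg ((L h ω c - L 0 ω c) - (L h ω c' - L 0 ω c')),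
        sq_nonneg (L h ω c - L 0 ω c), sq_nonneg (L h ω c' - L 0 ω c')]
    · simpa using (hGd c).add (hGd c')
  have hz : ∀ c, ∫ ω, L 1 ω c ∂μ = 0 := fun c => by
    rw [← hL.integral_increment hL2 hL0 c 0 1]
    refine integral_congr_ae ?_
    filter_upwards [hL.zero] with ω hω
    simp [hω]
  rw [hGi, eq_mul_of_additive_of_tendsto_zero (hGadd c c') hG0 (by linarith), covariance, hz, hz]
  congr 1
  refine integral_congr_ae ?_
  filter_upwards [hL.zero] with ω hω
  simp [hω]

end IsTwoSidedLevy

/-! ### Increments of a Lévy process as vectors of complex `L²` -/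

namespace IsTwoSidedLevy

variable {Ω : Type*} [MeasurableSpace Ω] {μ : Measure Ω} [IsProbabilityMeasure μ] {m : ℕ}
  {L : ℝ → Ω → (Fin m → ℝ)}

lemma memLp_complex_increment (hL : IsTwoSidedLevy L μ) (hL2 : MemLp (L 1) 2 μ) (c : Fin m)
    (t : ℝ) : MemLp (fun ω => ((L t ω c - L 0 ω c : ℝ) : ℂ)) 2 μ :=
  (hL.memLp_increment hL2 c 0 t).ofReal

lemma inner_toLp_sub (hL : IsTwoSidedLevy L μ) (hL2 : MemLp (L 1) 2 μ) (c c' : Fin m)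
    (s t s' t' : ℝ) :
    ⟪(hL.memLp_complex_increment hL2 c t).toLp - (hL.memLp_complex_increment hL2 c s).toLp,
      (hL.memLp_complex_increment hL2 c' t').toLp -
        (hL.memLp_complex_increment hL2 c' s').toLp⟫_ℂ =
      ((∫ ω, (L t ω c - L s ω c) * (L t' ω c' - L s' ω c') ∂μ : ℝ) : ℂ) := by
  rw [L2.inner_def, ← integral_complex_ofReal]
  refine integral_congr_ae ?_
  filter_upwards [(hL.memLp_complex_increment hL2 c t).coeFn_toLp,
    (hL.memLp_complex_increment hL2 c s).coeFn_toLp,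
    (hL.memLp_complex_increment hL2 c' t').coeFn_toLp,
    (hL.memLp_complex_increment hL2 c' s').coeFn_toLp,
    Lp.coeFn_sub (hL.memLp_complex_increment hL2 c t).toLp
      (hL.memLp_complex_increment hL2 c s).toLp,
    Lp.coeFn_sub (hL.memLp_complex_increment hL2 c' t').toLp
      (hL.memLp_complex_increment hL2 c' s').toLp] with ω h1 h2 h3 h4 h5 h6
  rw [h5, h6, Pi.sub_apply, Pi.sub_apply, h1, h2, h3, h4]
  simp only [RCLike.inner_apply, map_sub, Complex.conj_ofReal]
  push_cast
  ring

lemma isSquareIntegrableVersion (hL : IsTwoSidedLevy L μ) (hL2 : MemLp (L 1) 2 μ)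
    (hL0 : ∫ ω, L 1 ω ∂μ = 0) :
    IsSquareIntegrableVersion μ L (fun c t => (hL.memLp_complex_increment hL2 c t).toLp)
      (covMatrix μ (L 1)) := by
  refine ⟨fun c t => (hL.memLp_complex_increment hL2 c t).coeFn_toLp, fun c c' s t => ?_⟩
  have h0 : ∀ c, (hL.memLp_complex_increment hL2 c 0).toLp = 0 := fun c => by
    rw [Lp.eq_zero_iff_ae_eq_zero]
    filter_upwards [(hL.memLp_complex_increment hL2 c 0).coeFn_toLp] with ω h
    rw [h]
    simp
  rw [inner_stepLp]
  refine inner_eq_of_orthogonal_increments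
    (v := fun t => (hL.memLp_complex_increment hL2 c t).toLp)
    (v' := fun t => (hL.memLp_complex_increment hL2 c' t).toLp) (h0 c) (h0 c')
    (fun r s t hrs hst => ?_) (fun r s t hrs hst => ?_) (fun s t hst => ?_) s t
  · rw [hL.inner_toLp_sub hL2, hL.integral_increment_mul_eq_zero hL2 hL0 _ _ hrs hst,
      Complex.ofReal_zero]
  · rw [hL.inner_toLp_sub hL2]
    simp_rw [mul_comm (L t _ c - _)]
    rw [hL.integral_increment_mul_eq_zero hL2 hL0 _ _ hrs hst, Complex.ofReal_zero]
  · rw [hL.inner_toLp_sub hL2, hL.integral_increment_mul_increment hL2 hL0 _ _ hst, covMatrix,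
      Matrix.of_apply]
    push_cast
    ring

lemma inner_const_toLp (hL : IsTwoSidedLevy L μ) (hL2 : MemLp (L 1) 2 μ)
    (hL0 : ∫ ω, L 1 ω ∂μ = 0) (c : Fin m) (t : ℝ) :
    ⟪(memLp_const (1 : ℂ) : MemLp (fun _ : Ω => (1 : ℂ)) 2 μ).toLp,
      (hL.memLp_complex_increment hL2 c t).toLp⟫_ℂ = 0 := by
  have h0 := congrArg Complex.ofReal (hL.integral_increment hL2 hL0 c 0 t)
  rw [← integral_complex_ofReal, Complex.ofReal_zero] at h0
  rw [L2.inner_def]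
  refine Eq.trans (integral_congr_ae ?_) h0
  filter_upwards [(hL.memLp_complex_increment hL2 c t).coeFn_toLp,
    (memLp_const (1 : ℂ) : MemLp (fun _ : Ω => (1 : ℂ)) 2 μ).coeFn_toLp] with ω h1 h2
  rw [h1, h2]
  simp

end IsTwoSidedLevy

/-! ### Exponential decay of `e^{u R}` -/

section

open Asymptotics

/-- `f` is continuous and decays exponentially at `+∞`. -/
def ExpDecay (f : ℝ → ℂ) : Prop :=
  Continuous f ∧ ∃ b > 0, f =O[atTop] fun u => Real.exp (-b * u)

lemma ExpDecay.zero : ExpDecay fun _ => 0 :=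
  ⟨continuous_const, 1, one_pos, isBigO_zero _ _⟩

lemma ExpDecay.add {f g : ℝ → ℂ} (hf : ExpDecay f) (hg : ExpDecay g) :
    ExpDecay fun u => f u + g u := by
  obtain ⟨hf, b, hb, hfb⟩ := hf
  obtain ⟨hg, b', hb', hgb⟩ := hg
  refine ⟨hf.add hg, min b b', lt_min hb hb', (hfb.trans ?_).add (hgb.trans ?_)⟩
  all_goals
    refine IsBigO.of_bound 1 ?_
    filter_upwards [eventually_ge_atTop 0] with u hu
    rw [one_mul, Real.norm_of_nonneg (Real.exp_pos _).le, Real.norm_of_nonneg (Real.exp_pos _).le,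
      Real.exp_le_exp]
  · nlinarith [min_le_left b b']
  · nlinarith [min_le_right b b']

lemma ExpDecay.sum {ι : Type*} {s : Finset ι} {f : ι → ℝ → ℂ} (hf : ∀ i ∈ s, ExpDecay (f i)) :
    ExpDecay fun u => ∑ i ∈ s, f i u := by
  classical
  induction s using Finset.induction_on with
  | empty => simpa using ExpDecay.zero
  | insert i s hi ih =>
    simp only [Finset.sum_insert hi]
    exact (hf i (Finset.mem_insert_self i s)).add
      (ih fun j hj => hf j (Finset.mem_insert_of_mem hj))

lemma ExpDecay.mul {f g : ℝ → ℂ} (hf : ExpDecay f) (hg : ExpDecay g) :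
    ExpDecay fun u => f u * g u := by
  obtain ⟨hf, b, hb, hfb⟩ := hf
  obtain ⟨hg, b', hb', hgb⟩ := hg
  refine ⟨hf.mul hg, b + b', add_pos hb hb', (hfb.mul hgb).congr_right fun u => ?_⟩
  rw [← Real.exp_add]
  ring_nf

lemma ExpDecay.const_mul {f : ℝ → ℂ} (hf : ExpDecay f) (c : ℂ) : ExpDecay fun u => c * f u := by
  obtain ⟨hf, b, hb, hfb⟩ := hf
  exact ⟨continuous_const.mul hf, b, hb, hfb.const_mul_left c⟩

lemma ExpDecay.mul_const {f : ℝ → ℂ} (hf : ExpDecay f) (c : ℂ) : ExpDecay fun u => f u * c := by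
  simpa only [mul_comm c] using hf.const_mul c

lemma ExpDecay.star {f : ℝ → ℂ} (hf : ExpDecay f) : ExpDecay fun u => star (f u) := by
  obtain ⟨hf, b, hb, hfb⟩ := hf
  refine ⟨continuous_star.comp hf, b, hb, IsBigO.of_norm_left ?_⟩
  simp_rw [norm_star]
  exact hfb.norm_left

lemma ExpDecay.integrableOn {f : ℝ → ℂ} (hf : ExpDecay f) (a : ℝ) :
    IntegrableOn f (Set.Ioi a) := by
  obtain ⟨hf, b, hb, hfb⟩ := hf
  have h := integrable_of_isBigO_exp_neg (a := a) hb hf.norm.continuousOn hfb.norm_left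
  exact (integrable_norm_iff hf.aestronglyMeasurable).mp h

lemma ExpDecay.memLp {f : ℝ → ℂ} (hf : ExpDecay f) (a : ℝ) :
    MemLp f 2 (volume.restrict (Set.Ioi a)) := by
  rw [memLp_two_iff_integrable_sq_norm hf.1.aestronglyMeasurable]
  have h := ((hf.mul hf).integrableOn a).norm
  simp_rw [norm_mul, ← sq] at h
  exact h

lemma expDecay_pow_mul_exp (n : ℕ) {z : ℂ} (hz : z.re < 0) :
    ExpDecay fun u => (u : ℂ) ^ n * Complex.exp (u * z) := by
  -- Half of the decay rate absorbs the polynomial factor.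
  refine ⟨by fun_prop, -z.re / 2, by linarith, ?_⟩
  have h := (isLittleO_pow_exp_pos_mul_atTop n (b := -z.re / 2) (by linarith)).isBigO
  have h2 := h.mul (isBigO_refl (fun u : ℝ => Real.exp (z.re * u)) atTop)
  refine IsBigO.of_norm_left ?_
  have h3 : ∀ u : ℝ, ‖(u : ℂ) ^ n * Complex.exp (u * z)‖ = ‖u ^ n * Real.exp (z.re * u)‖ := by
    intro u
    rw [norm_mul, norm_mul, norm_pow, norm_pow, Complex.norm_real, Complex.norm_exp,
      Real.norm_of_nonneg (Real.exp_pos _).le]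
    simp [mul_comm]
  simp_rw [h3]
  refine h2.norm_left.congr_right fun u => ?_
  rw [← Real.exp_add]
  ring_nf

lemma exp_smul_mulVec_of_pow_mulVec_eq_zero {d : ℕ} {N : Matrix (Fin d) (Fin d) ℂ}
    {v : Fin d → ℂ} {k : ℕ} (h : (N ^ k) *ᵥ v = 0) (u : ℝ) :
    NormedSpace.exp (u • N) *ᵥ v =
      ∑ n ∈ Finset.range k, ((n.factorial : ℂ)⁻¹ * (u : ℂ) ^ n) • ((N ^ n) *ᵥ v) := by
  let _ : NormedRing (Matrix (Fin d) (Fin d) ℂ) := Matrix.linftyOpNormedRing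
  let _ : NormedAlgebra ℂ (Matrix (Fin d) (Fin d) ℂ) := Matrix.linftyOpNormedAlgebra
  have h1 : HasSum (fun n : ℕ => ((n.factorial : ℂ)⁻¹) • (u • N) ^ n) (NormedSpace.exp (u • N)) :=
    NormedSpace.exp_series_hasSum_exp' (u • N)
  have h2 := h1.map (AddMonoidHom.mk' (fun M : Matrix (Fin d) (Fin d) ℂ => M *ᵥ v)
    fun M M' => Matrix.add_mulVec M M' v) (by
      change Continuous fun M : Matrix (Fin d) (Fin d) ℂ => M *ᵥ v
      fun_prop)
  have h3 : (u • N) = (u : ℂ) • N := by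
    ext a b
    simp
  have h4 : ∀ n : ℕ, (((n.factorial : ℂ)⁻¹) • (u • N) ^ n) *ᵥ v =
      ((n.factorial : ℂ)⁻¹ * (u : ℂ) ^ n) • ((N ^ n) *ᵥ v) := fun n => by
    rw [h3, _root_.smul_pow, smul_smul, Matrix.smul_mulVec]
  refine h2.unique ?_
  have h5 : ∀ n ∉ Finset.range k, ((n.factorial : ℂ)⁻¹ * (u : ℂ) ^ n) • ((N ^ n) *ᵥ v) = 0 := by
    intro n hn
    rw [Finset.mem_range, not_lt] at hn
    rw [show N ^ n = N ^ (n - k) * N ^ k by rw [← pow_add, Nat.sub_add_cancel hn],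
      ← Matrix.mulVec_mulVec, h, Matrix.mulVec_zero, smul_zero]
  have h6 : (AddMonoidHom.mk' (fun M : Matrix (Fin d) (Fin d) ℂ => M *ᵥ v)
      fun M M' => Matrix.add_mulVec M M' v) ∘ (fun n => ((n.factorial : ℂ)⁻¹) • (u • N) ^ n) =
      fun n => ((n.factorial : ℂ)⁻¹ * (u : ℂ) ^ n) • ((N ^ n) *ᵥ v) := funext h4
  rw [h6]
  exact hasSum_sum_of_ne_finset_zero h5

lemma exp_smul_eq_exp_smul_exp_sub {d : ℕ} (R : Matrix (Fin d) (Fin d) ℂ) (z : ℂ) (u : ℝ) :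
    NormedSpace.exp (u • R) =
      Complex.exp (u * z) • NormedSpace.exp (u • (R - algebraMap ℂ _ z)) := by
  have h1 : u • R = algebraMap ℂ _ (u * z) + u • (R - algebraMap ℂ _ z) := by
    rw [smul_sub, map_mul]
    have : u • algebraMap ℂ (Matrix (Fin d) (Fin d) ℂ) z = algebraMap ℂ _ (u : ℂ) *
        algebraMap ℂ _ z := by
      rw [← map_mul]
      ext a b
      simp [Matrix.algebraMap_matrix_apply]
    rw [this]
    abel
  rw [h1, Matrix.exp_add_of_commute _ _ (Algebra.commute_algebraMap_left _ _)]
  have h2 : NormedSpace.exp (algebraMap ℂ (Matrix (Fin d) (Fin d) ℂ) (u * z)) =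
      algebraMap ℂ _ (Complex.exp (u * z)) := by
    rw [Matrix.algebraMap_eq_diagonal, Matrix.exp_diagonal, Matrix.algebraMap_eq_diagonal]
    congr 1
    funext i
    simp [Complex.exp_eq_exp_ℂ, NormedSpace.exp_eq_tsum_div]
  rw [h2, ← Algebra.smul_def]

/-- `ℂᵈ` is the sum of the generalized eigenspaces of `R`. On the one for `z`, the matrix `R - z`
acts nilpotently, so `e^{uR} v` is `e^{uz}` times a polynomial in `u`. -/
lemma expDecay_exp_mulVec {d : ℕ} {R : Matrix (Fin d) (Fin d) ℂ}
    (hR : ∀ z ∈ spectrum ℂ R, z.re < 0) (v : Fin d → ℂ) (a : Fin d) :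
    ExpDecay fun u => (NormedSpace.exp (u • R) *ᵥ v) a := by
  have hv : v ∈ ⨆ z : ℂ, Module.End.maxGenEigenspace (Matrix.toLin' R) z := by
    rw [Module.End.iSup_maxGenEigenspace_eq_top]
    trivial
  refine Submodule.iSup_induction _ (motive := fun v =>
    ExpDecay fun u => (NormedSpace.exp (u • R) *ᵥ v) a) hv ?_ ?_ ?_
  · intro z v hv
    obtain ⟨k, hk⟩ := Module.End.mem_maxGenEigenspace _ _ _ |>.mp hv
    have hk' : (R - algebraMap ℂ _ z) ^ k *ᵥ v = 0 := by
      rw [← hk, ← Matrix.toLin'_apply, Matrix.toLin'_pow, map_sub]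
      congr 3
      rw [Algebra.algebraMap_eq_smul_one, map_smul, Matrix.toLin'_one]
      rfl
    by_cases hz : z ∈ spectrum ℂ R
    · simp_rw [exp_smul_eq_exp_smul_exp_sub R z, Matrix.smul_mulVec,
        exp_smul_mulVec_of_pow_mulVec_eq_zero hk', Pi.smul_apply, Finset.sum_apply, Pi.smul_apply,
        Finset.smul_sum, smul_eq_mul]
      refine ExpDecay.sum fun n _ => ?_
      convert (expDecay_pow_mul_exp n (hR z hz)).mul_const
        ((n.factorial : ℂ)⁻¹ * ((R - algebraMap ℂ _ z) ^ n *ᵥ v) a) using 2 with u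
      ring
    -- The supremum runs over all `z ∈ ℂ`; off the spectrum the generalized eigenspace is zero.
    · have hu : IsUnit ((R - algebraMap ℂ _ z) ^ k) := by
        rw [spectrum.notMem_iff] at hz
        rw [← neg_sub]
        exact hz.neg.pow k
      obtain ⟨U, hU⟩ := hu
      have h0 : v = 0 := by
        have h1 := congrArg (fun w => (↑U⁻¹ : Matrix (Fin d) (Fin d) ℂ) *ᵥ w) hk'
        simpa [← hU] using h1
      simpa [h0] using ExpDecay.zero
  · simpa using ExpDecay.zero
  · intro v w hv hw
    simp_rw [Matrix.mulVec_add, Pi.add_apply]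
    exact hv.add hw

lemma expDecay_exp_mul {d m : ℕ} {R : Matrix (Fin d) (Fin d) ℂ}
    (hR : ∀ z ∈ spectrum ℂ R, z.re < 0) (N : Matrix (Fin d) (Fin m) ℂ) (a : Fin d) (c : Fin m) :
    ExpDecay fun u => (NormedSpace.exp (u • R) * N) a c :=
  expDecay_exp_mulVec hR (fun b => N b c) a

end

/-! ### Kernels of Ornstein-Uhlenbeck processes -/

lemma ExpDecay.memLp_indicator_comp_sub {f : ℝ → ℂ} (hf : ExpDecay f) (t : ℝ) :
    MemLp ((Set.Iic t).indicator fun u => f (t - u)) 2 volume := by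
  have h1 : MemLp ((Set.Ici 0).indicator f) 2 volume := by
    rw [memLp_indicator_iff_restrict measurableSet_Ici]
    -- Any negative number works: the open half-line only has to contain `0`.
    exact (hf.memLp (-1)).mono_measure
      (Measure.restrict_mono (Set.Ici_subset_Ioi.mpr (by simp)) le_rfl)
  have h2 := h1.comp_measurePreserving (Measure.measurePreserving_sub_left volume t)
  refine h2.ae_eq (ae_of_all _ fun u => ?_)
  simp [Set.indicator_apply]

/-- The function `u ↦ f (t - u)` on `(-∞, t]`, as an element of `L²(ℝ)`. -/
def kernelLp {f : ℝ → ℂ} (hf : ExpDecay f) (t : ℝ) : Lp ℂ 2 (volume : Measure ℝ) :=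
  (hf.memLp_indicator_comp_sub t).toLp

/-- For `l ≥ 0` the product of the kernels is supported on `(-∞, t]`. Reflecting by `u ↦ t - u`
removes `t`, which is the source of stationarity. -/
lemma inner_kernelLp {f g : ℝ → ℂ} (hf : ExpDecay f) (hg : ExpDecay g) (t : ℝ) {l : ℝ}
    (hl : 0 ≤ l) :
    ⟪kernelLp hf t, kernelLp hg (t + l)⟫_ℂ = ∫ u in Set.Ioi 0, g (l + u) * star (f u) := by
  have h1 : ⟪kernelLp hf t, kernelLp hg (t + l)⟫_ℂ =
      ∫ u, (Set.Ici 0).indicator (fun u => g (l + u) * star (f u)) (t - u) := by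
    rw [L2.inner_def]
    refine integral_congr_ae ?_
    filter_upwards [(hf.memLp_indicator_comp_sub t).coeFn_toLp,
      (hg.memLp_indicator_comp_sub (t + l)).coeFn_toLp] with u h1 h2
    rw [kernelLp, kernelLp, h1, h2]
    by_cases hu : u ≤ t
    · have hu' : u ≤ t + l := by linarith
      simp only [Set.indicator_apply, Set.mem_Iic, Set.mem_Ici, sub_nonneg, hu, hu', if_true,
        RCLike.inner_apply]
      rw [show l + (t - u) = t + l - u by ring]
      rfl
    · simp [Set.indicator_apply, hu]
  rw [h1, integral_sub_left_eq_self (fun u => (Set.Ici 0).indicator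
    (fun u => g (l + u) * star (f u)) u) volume t, integral_indicator measurableSet_Ici,
    integral_Ici_eq_integral_Ioi]

/-! ### The covariance integrand -/

section

variable {d m : ℕ}

lemma covIntegrand_eq (S : Matrix (Fin m) (Fin m) ℂ) (R : Matrix (Fin d) (Fin d) ℂ)
    (N : Matrix (Fin d) (Fin m) ℂ) (R' : Matrix (Fin d) (Fin d) ℂ)
    (N' : Matrix (Fin d) (Fin m) ℂ) (u : ℝ) :
    covIntegrand S R N R' N' u =
      (NormedSpace.exp (u • R) * N) * S * (NormedSpace.exp (u • R') * N')ᴴ := by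
  have h : NormedSpace.exp (u • R'ᴴ) = (NormedSpace.exp (u • R'))ᴴ := by
    rw [← Matrix.exp_conjTranspose, Matrix.conjTranspose_smul, star_trivial]
  rw [covIntegrand, h, Matrix.conjTranspose_mul]
  simp only [Matrix.mul_assoc]

lemma exp_mul_covIntegrand (S : Matrix (Fin m) (Fin m) ℂ) (R : Matrix (Fin d) (Fin d) ℂ)
    (N : Matrix (Fin d) (Fin m) ℂ) (R' : Matrix (Fin d) (Fin d) ℂ)
    (N' : Matrix (Fin d) (Fin m) ℂ) (l u : ℝ) :
    NormedSpace.exp (l • R) * covIntegrand S R N R' N' u =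
      (NormedSpace.exp ((l + u) • R) * N) * S * (NormedSpace.exp (u • R') * N')ᴴ := by
  rw [covIntegrand_eq, add_smul, Matrix.exp_add_of_commute _ _
    (((Commute.refl R).smul_left l).smul_right u)]
  simp only [Matrix.mul_assoc]

lemma mul_mul_conjTranspose_apply (P Q : Matrix (Fin d) (Fin m) ℂ) (S : Matrix (Fin m) (Fin m) ℂ)
    (a b : Fin d) : (P * S * Qᴴ) a b = ∑ c', ∑ c, S c c' * (P a c * star (Q b c')) := by
  simp only [Matrix.mul_apply, Matrix.conjTranspose_apply, Finset.sum_mul]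
  refine Finset.sum_congr rfl fun c' _ => Finset.sum_congr rfl fun c _ => ?_
  ring

variable {S : Matrix (Fin m) (Fin m) ℂ} {R R' : Matrix (Fin d) (Fin d) ℂ}
  {N N' : Matrix (Fin d) (Fin m) ℂ}

lemma expDecay_covIntegrand (hR : ∀ z ∈ spectrum ℂ R, z.re < 0)
    (hR' : ∀ z ∈ spectrum ℂ R', z.re < 0) (a b : Fin d) :
    ExpDecay fun u => covIntegrand S R N R' N' u a b := by
  simp_rw [covIntegrand_eq, mul_mul_conjTranspose_apply]
  exact ExpDecay.sum fun c' _ => ExpDecay.sum fun c _ =>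
    ((expDecay_exp_mul hR N a c).mul (expDecay_exp_mul hR' N' b c').star).const_mul _

lemma exp_mul_integralIoi_covIntegrand_apply (hR : ∀ z ∈ spectrum ℂ R, z.re < 0)
    (hR' : ∀ z ∈ spectrum ℂ R', z.re < 0) (t : ℝ) {l : ℝ} (hl : 0 ≤ l) (a b : Fin d) :
    (NormedSpace.exp (l • R) * integralIoi (covIntegrand S R N R' N')) a b =
      ∑ c', ∑ c, S c c' *
        ⟪kernelLp (expDecay_exp_mul hR' N' b c') t,
          kernelLp (expDecay_exp_mul hR N a c) (t + l)⟫_ℂ := by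
  have hshift : ∀ c c', IntegrableOn (fun u => S c c' * ((NormedSpace.exp ((l + u) • R) * N) a c *
      star ((NormedSpace.exp (u • R') * N') b c'))) (Set.Ioi 0) := by
    intro c c'
    -- The shift by `l` is absorbed into the constant matrix, so the decay of `e^{uR}` applies
    -- again.
    have h1 : ∀ u : ℝ, (NormedSpace.exp ((l + u) • R) * N) a c =
        (NormedSpace.exp (u • R) * (NormedSpace.exp (l • R) * N)) a c := fun u => by
      rw [add_comm, add_smul, Matrix.exp_add_of_commute _ _
        (((Commute.refl R).smul_left u).smul_right l), Matrix.mul_assoc]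
    simp_rw [h1]
    exact (((expDecay_exp_mul hR _ a c).mul (expDecay_exp_mul hR' N' b c').star).const_mul
      _).integrableOn 0
  calc (NormedSpace.exp (l • R) * integralIoi (covIntegrand S R N R' N')) a b
      = ∫ u in Set.Ioi 0, (NormedSpace.exp (l • R) * covIntegrand S R N R' N' u) a b := by
        simp only [Matrix.mul_apply, integralIoi, Matrix.of_apply]
        rw [integral_finsetSum _ fun e _ =>
          ((expDecay_covIntegrand hR hR' e b).const_mul _).integrableOn 0]
        simp_rw [integral_const_mul]
    _ = ∫ u in Set.Ioi 0, ∑ c', ∑ c, S c c' * ((NormedSpace.exp ((l + u) • R) * N) a c *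
          star ((NormedSpace.exp (u • R') * N') b c')) := by
        simp_rw [exp_mul_covIntegrand, mul_mul_conjTranspose_apply]
    _ = _ := by
        rw [integral_finsetSum _ fun c' _ => integrable_finsetSum _ fun c _ => hshift c c']
        refine Finset.sum_congr rfl fun c' _ => ?_
        rw [integral_finsetSum _ fun c _ => hshift c c']
        refine Finset.sum_congr rfl fun c _ => ?_
        rw [integral_const_mul, inner_kernelLp _ _ t hl]

end

/-! ### Superpositions of Ornstein-Uhlenbeck processes -/

section

variable {Ω : Type*} [MeasurableSpace Ω] {μ : Measure Ω} [IsProbabilityMeasure μ] {p d m : ℕ}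
  {L : ℝ → Ω → (Fin m → ℝ)} {X : Fin m → ℝ → Lp ℂ 2 μ} {S : Matrix (Fin m) (Fin m) ℂ}

omit [IsProbabilityMeasure μ] in
lemma ouProcess_ae_eq (hX : IsSquareIntegrableVersion μ L X S) {R : Matrix (Fin d) (Fin d) ℂ}
    (hR : ∀ z ∈ spectrum ℂ R, z.re < 0) (N : Matrix (Fin d) (Fin m) ℂ) (t : ℝ) :
    ouProcess μ R N L t =ᵐ[μ]
      stochIntegral X fun a c => kernelLp (expDecay_exp_mul hR N a c) t :=
  integralFromBot_ae_eq (isIntegralFromBot_stochIntegral hX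
    (g := fun u => NormedSpace.exp ((t - u) • R) * N)
    (fun a c => (expDecay_exp_mul hR N a c).1.comp (continuous_const.sub continuous_id))
    fun a c => (expDecay_exp_mul hR N a c).memLp_indicator_comp_sub t)

/-- Orthogonality to `1` kills the means. The arguments swap because the inner product is conjugate
linear in the first one. -/
lemma crossCov_apply_of_ae_eq {U V : Ω → (Fin d → ℂ)} {Z W : Fin d → Lp ℂ 2 μ}
    (hU : ∀ᵐ ω ∂μ, ∀ a, U ω a = Z a ω) (hV : ∀ᵐ ω ∂μ, ∀ a, V ω a = W a ω)
    (hZ : ∀ a, ⟪(memLp_const (1 : ℂ) : MemLp (fun _ : Ω => (1 : ℂ)) 2 μ).toLp, Z a⟫_ℂ = 0)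
    (hW : ∀ a, ⟪(memLp_const (1 : ℂ) : MemLp (fun _ : Ω => (1 : ℂ)) 2 μ).toLp, W a⟫_ℂ = 0)
    (a b : Fin d) : crossCov μ U V a b = ⟪W b, Z a⟫_ℂ := by
  have h0 : ∀ (U : Ω → (Fin d → ℂ)) (Z : Fin d → Lp ℂ 2 μ), (∀ᵐ ω ∂μ, ∀ a, U ω a = Z a ω) →
      (∀ a, ⟪(memLp_const (1 : ℂ) : MemLp (fun _ : Ω => (1 : ℂ)) 2 μ).toLp, Z a⟫_ℂ = 0) →
      ∀ a, ∫ ω, U ω a ∂μ = 0 := by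
    intro U Z hU hZ a
    refine Eq.trans ?_ (hZ a)
    rw [L2.inner_def]
    refine integral_congr_ae ?_
    filter_upwards [hU,
      (memLp_const (1 : ℂ) : MemLp (fun _ : Ω => (1 : ℂ)) 2 μ).coeFn_toLp] with ω h1 h2
    rw [h1, h2]
    simp
  rw [crossCov, Matrix.of_apply, h0 U Z hU hZ, h0 V W hV hW, L2.inner_def]
  refine integral_congr_ae ?_
  filter_upwards [hU, hV] with ω h1 h2
  rw [h1, h2, sub_zero, sub_zero]
  rfl

variable {R : Fin p → Matrix (Fin d) (Fin d) ℂ} {Y : ℝ → Ω → (Fin d → ℂ)}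

/-- The components of a sum of Ornstein-Uhlenbeck processes at time `t`. -/
def ouSumLp (X : Fin m → ℝ → Lp ℂ 2 μ) (hR : ∀ k, ∀ z ∈ spectrum ℂ (R k), z.re < 0)
    (N : Fin p → Matrix (Fin d) (Fin m) ℂ) (t : ℝ) (a : Fin d) : Lp ℂ 2 μ :=
  ∑ k, ∑ c, wienerMap (X c) (kernelLp (expDecay_exp_mul (hR k) (N k) a c) t)

omit [IsProbabilityMeasure μ] in
lemma ae_eq_ouSumLp (hX : IsSquareIntegrableVersion μ L X S)
    (hR : ∀ k, ∀ z ∈ spectrum ℂ (R k), z.re < 0) (N : Fin p → Matrix (Fin d) (Fin m) ℂ) {t : ℝ}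
    (hY : ∀ᵐ ω ∂μ, Y t ω = ∑ k, ouProcess μ (R k) (N k) L t ω) :
    ∀ᵐ ω ∂μ, ∀ a, Y t ω a = ouSumLp X hR N t a ω := by
  have h1 : ∀ᵐ ω ∂μ, ∀ k, ouProcess μ (R k) (N k) L t ω =
      stochIntegral X (fun a c => kernelLp (expDecay_exp_mul (hR k) (N k) a c) t) ω :=
    ae_all_iff.mpr fun k => ouProcess_ae_eq hX (hR k) (N k) t
  have h2 : ∀ᵐ ω ∂μ, ∀ k, stochIntegral X
      (fun a c => kernelLp (expDecay_exp_mul (hR k) (N k) a c) t) ω = fun a =>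
        (∑ c, wienerMap (X c) (kernelLp (expDecay_exp_mul (hR k) (N k) a c) t) : Lp ℂ 2 μ) ω :=
    ae_all_iff.mpr fun k => coeFn_vecLp _
  have h3 : ∀ᵐ ω ∂μ, ∀ a, ouSumLp X hR N t a ω = ∑ k,
      (∑ c, wienerMap (X c) (kernelLp (expDecay_exp_mul (hR k) (N k) a c) t) : Lp ℂ 2 μ) ω := by
    rw [ae_all_iff]
    intro a
    filter_upwards [Lp.coeFn_finsetSum Finset.univ fun k =>
      ∑ c, wienerMap (X c) (kernelLp (expDecay_exp_mul (hR k) (N k) a c) t)] with ω h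
    rw [ouSumLp, h, Finset.sum_apply]
  filter_upwards [hY, h1, h2, h3] with ω e0 e1 e2 e3 a
  rw [e0, e3, Finset.sum_apply]
  refine Finset.sum_congr rfl fun k _ => ?_
  rw [e1, e2]

omit [IsProbabilityMeasure μ] in
lemma inner_ouSumLp (hX : IsSquareIntegrableVersion μ L X S) (hS : ∀ c c', S c c' = S c' c)
    (hR : ∀ k, ∀ z ∈ spectrum ℂ (R k), z.re < 0) (N : Fin p → Matrix (Fin d) (Fin m) ℂ) (t : ℝ)
    {l : ℝ} (hl : 0 ≤ l) (a b : Fin d) :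
    ⟪ouSumLp X hR N t b, ouSumLp X hR N (t + l) a⟫_ℂ =
      (∑ i, NormedSpace.exp (l • R i) *
        ∑ j, integralIoi (covIntegrand S (R i) (N i) (R j) (N j))) a b := by
  simp_rw [Matrix.sum_apply, Finset.mul_sum, Matrix.sum_apply,
    exp_mul_integralIoi_covIntegrand_apply (hR _) (hR _) t hl a b]
  simp_rw [ouSumLp, inner_sum]
  refine Finset.sum_congr rfl fun i _ => ?_
  simp_rw [sum_inner]
  rw [Finset.sum_comm]
  refine Finset.sum_congr rfl fun j _ => ?_
  rw [Finset.sum_comm]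
  refine Finset.sum_congr rfl fun c' _ => Finset.sum_congr rfl fun c _ => ?_
  -- The swap of arguments produces `S c' c`, whereas the matrix product has `S c c'`.
  rw [inner_wienerMap (hX.gram c' c') (hX.gram c c) (hX.gram c' c), hS c c']

end

end

end MCARMA

open MCARMA in
theorem mainTheorem4 {Ω : Type*} [MeasurableSpace Ω] (μ : Measure Ω) [IsProbabilityMeasure μ]
    {p q d m : ℕ} (hqp : q < p)
    (A : Fin p → Matrix (Fin d) (Fin d) ℝ) (B : Fin (q + 1) → Matrix (Fin d) (Fin m) ℝ)
    (hAB : MCARMA.LeftCoprime (MCARMA.arPoly A) (MCARMA.maPoly B))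
    (R : Fin p → Matrix (Fin d) (Fin d) ℂ) (hR : MCARMA.IsCompleteRegularSolventSet A R)
    (hstable : ∀ z ∈ MCARMA.polySpectrum (MCARMA.arPoly A), z.re < 0)
    (Γ : Fin p → ℝ → ℂ)
    (hΓ : ∀ k, MCARMA.Separates (Γ k) (spectrum ℂ (R k))
      (MCARMA.polySpectrum (MCARMA.arPoly A) \ spectrum ℂ (R k)))
    (res : Fin p → Matrix (Fin d) (Fin m) ℂ)
    (hres : ∀ k, res k = MCARMA.contourResidue (MCARMA.transferFun A B) (Γ k))
    (L : ℝ → Ω → (Fin m → ℝ)) (hL : MCARMA.IsTwoSidedLevy L μ)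
    (hL2 : MemLp (L 1) 2 μ) (hL0 : ∫ ω, L 1 ω ∂μ = 0)
    (Y : ℝ → Ω → (Fin d → ℂ))
    (hY : ∀ t, ∀ᵐ ω ∂μ, Y t ω = ∑ k, MCARMA.ouProcess μ (R k) (res k) L t ω) :
    (∀ t, MemLp (Y t) 2 μ) ∧
    (∀ i j a b, IntegrableOn
      (fun u => MCARMA.covIntegrand (MCARMA.covMatrix μ (L 1)) (R i) (res i) (R j) (res j) u a b)
      (Set.Ioi 0)) ∧
    ∀ t l : ℝ, 0 ≤ l →
      MCARMA.crossCov μ (Y (t + l)) (Y t) =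
        ∑ i, NormedSpace.exp (l • R i) *
          ∑ j, MCARMA.integralIoi
            (MCARMA.covIntegrand (MCARMA.covMatrix μ (L 1)) (R i) (res i) (R j) (res j)) := by
  -- Completeness of the solvent set places each `σ(R_k)` inside `σ(A(·))`.
  have hR' : ∀ k, ∀ z ∈ spectrum ℂ (R k), z.re < 0 := fun k z hz =>
    hstable z (hR.2 ▸ Set.mem_iUnion_of_mem k hz)
  have hX := hL.isSquareIntegrableVersion hL2 hL0
  have hYt := fun t => ae_eq_ouSumLp hX hR' res (hY t)
  have hmean : ∀ t a, inner ℂ (memLp_const (1 : ℂ) : MemLp (fun _ : Ω => (1 : ℂ)) 2 μ).toLp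
      (ouSumLp (fun c t => (hL.memLp_complex_increment hL2 c t).toLp) hR' res t a) = 0 := by
    intro t a
    simp_rw [ouSumLp, inner_sum]
    refine Finset.sum_eq_zero fun k _ => Finset.sum_eq_zero fun c _ => ?_
    exact inner_wienerMap_eq_zero (hX.gram c c) (hL.inner_const_toLp hL2 hL0 c) _
  refine ⟨fun t => ?_, fun i j a b => (expDecay_covIntegrand (hR' i) (hR' j) a b).integrableOn 0,
    fun t l hl => ?_⟩
  · refine (Lp.memLp (vecLp (ouSumLp (fun c t => (hL.memLp_complex_increment hL2 c t).toLp)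
      hR' res t))).ae_eq ?_
    filter_upwards [hYt t, coeFn_vecLp (ouSumLp
      (fun c t => (hL.memLp_complex_increment hL2 c t).toLp) hR' res t)] with ω h1 h2
    rw [h2]
    exact (funext h1).symm
  · ext a b
    rw [crossCov_apply_of_ae_eq (hYt (t + l)) (hYt t) (hmean _) (hmean _), inner_ouSumLp hX
      (fun c c' => by simp [covMatrix, covariance_comm]) hR' res t hl]
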